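/- Let $\mathbb F_q$ be a finite field and let $n,l,m$ be integers with $1<m<n-1$ and $l>0$. Let $E$ be the subspace of $\mathbb F_q^{\,n+l}$ spanned by the last $l$ standard basis vectors, and let $X_m$ be the set of all subspaces of type $(m,0)$, that is, of all $m$-dimensional subspaces $P$ of $\mathbb F_q^{\,n+l}$ with $P\cap E=0$. For such $P$ write $P'\subseteq\mathbb F_q^{\,n}$ for the image of $P$ under the projection onto the first $n$ coordinates. Let $\Gamma^{(m)}=(X_m,R_{1,0})$ be the graph with vertex set $X_m$ in which $P$ and $Q$ are adjacent if and only if $\dim(P'\cap Q')=m-1$ and $\dim(P\cap Q)=m-1$. Let $P\Gamma L(n+l,\mathbb F_q)$ be the group of all invertible semilinear transformations of $\mathbb F_q^{\,n+l}$ modulo the nonzero scalars, acting on the set of subspaces of $\mathbb F_q^{\,n+l}$, and let $P\Gamma L(n+l,\mathbb F_q)_E$ be the stabilizer of $E$ in it. Then $$\operatorname{Aut}(\Gamma^{(m)})=P\Gamma L(n+l,\mathbb F_q)_E ,$$ in the sense that $g\mapsto (P\mapsto g(P))$ is a group isomorphism from $P\Gamma L(n+l,\mathbb F_q)_E$ onto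 the automorphism group of the graph $\Gamma^{(m)}$. -/

import Mathlib

/-! ### The projective semilinear group -/

section Semilinear

variable (F V : Type*) [Field F] [AddCommGroup V] [Module F V]

/-- The general semilinear group `ΓL(V)`: all bijections `g` of `V` that are additive and satisfy
`g (a • v) = σ a • g v` for some field automorphism `σ`. -/
def GammaL : Subgroup (Equiv.Perm V) where
  carrier := {g | (∀ v w : V, g (v + w) = g v + g w) ∧
    ∃ σ : F ≃+* F, ∀ (a : F) (v : V), g (a • v) = σ a • g v}
  one_mem' := ⟨fun _ _ => rfl, RingEquiv.refl F, fun _ _ => rfl⟩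
  mul_mem' := by
    rintro g h ⟨hg, σ, hσ⟩ ⟨hh, τ, hτ⟩
    refine ⟨fun v w => ?_, τ.trans σ, fun a v => ?_⟩
    · simp only [Equiv.Perm.mul_apply, hh, hg]
    · simp only [Equiv.Perm.mul_apply, hτ, hσ, RingEquiv.trans_apply]
  inv_mem' := by
    rintro g ⟨hg, σ, hσ⟩
    refine ⟨fun v w => ?_, σ.symm, fun a v => ?_⟩
    · apply g.injective
      simp only [hg, Equiv.Perm.coe_inv, Equiv.apply_symm_apply]
    · apply g.injective
      simp only [hσ, Equiv.Perm.coe_inv, Equiv.apply_symm_apply, RingEquiv.apply_symm_apply]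

/-- The subgroup of `ΓL(V)` formed by the maps `v ↦ c • v`, `c ∈ Fˣ`. -/
def scalarSubgroup : Subgroup (GammaL F V) where
  carrier := {g | ∃ c : Fˣ, ∀ v : V, (g : Equiv.Perm V) v = (c : F) • v}
  one_mem' := ⟨1, fun v => by simp⟩
  mul_mem' := by
    rintro g h ⟨c, hc⟩ ⟨d, hd⟩
    refine ⟨c * d, fun v => ?_⟩
    simp only [Subgroup.coe_mul, Equiv.Perm.mul_apply, hc, hd, Units.val_mul, mul_smul]
  inv_mem' := by
    rintro g ⟨c, hc⟩
    refine ⟨c⁻¹, fun v => ?_⟩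
    apply (g : Equiv.Perm V).injective
    rw [Subgroup.coe_inv, Equiv.Perm.coe_inv, Equiv.apply_symm_apply, hc, smul_smul, Units.mul_inv, one_smul]

instance scalarSubgroup_normal : (scalarSubgroup F V).Normal where
  conj_mem := by
    rintro h ⟨c, hc⟩ ⟨g, hg, σ, hσ⟩
    refine ⟨Units.map (σ : F →* F) c, fun v => ?_⟩
    simp only [Subgroup.coe_mul, Subgroup.coe_inv, Equiv.Perm.mul_apply, hc, hσ,
      Equiv.Perm.coe_inv, Equiv.apply_symm_apply]
    rfl

/-- The projective semilinear group `PΓL(V) = ΓL(V) / Fˣ`. -/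
def PGammaL : Type _ := GammaL F V ⧸ scalarSubgroup F V

instance : Group (PGammaL F V) :=
  inferInstanceAs (Group (GammaL F V ⧸ scalarSubgroup F V))

variable {F V}

/-- The class in `PΓL(V)` of a semilinear bijection. -/
def PGammaL.mk : GammaL F V →* PGammaL F V := QuotientGroup.mk' (scalarSubgroup F V)

/-- The image `g(W)` of a subspace `W` under a semilinear bijection `g`. -/
def GammaL.mapSubspace (g : GammaL F V) (W : Submodule F V) : Submodule F V where
  carrier := (g : Equiv.Perm V) '' W
  zero_mem' := by
    refine ⟨0, W.zero_mem, ?_⟩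
    have h := g.2.1 0 0
    rwa [add_zero, left_eq_add] at h
  add_mem' := by
    rintro _ _ ⟨x, hx, rfl⟩ ⟨y, hy, rfl⟩
    exact ⟨x + y, W.add_mem hx hy, g.2.1 x y⟩
  smul_mem' := by
    obtain ⟨g, hg, σ, hσ⟩ := g
    rintro a _ ⟨x, hx, rfl⟩
    refine ⟨σ.symm a • x, W.smul_mem _ hx, ?_⟩
    simp [hσ]

/-- `ΓL(V)` acts on the set of subspaces of `V` by `W ↦ g(W)`. -/
instance : MulAction (GammaL F V) (Submodule F V) where
  smul g W := GammaL.mapSubspace g W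
  one_smul _ := SetLike.coe_injective (Set.image_id _)
  mul_smul g h W := SetLike.coe_injective
    (Set.image_comp (g : Equiv.Perm V) (h : Equiv.Perm V) (W : Set V))

theorem GammaL.coe_smul (g : GammaL F V) (W : Submodule F V) :
    ((g • W : Submodule F V) : Set V) = (g : Equiv.Perm V) '' W := rfl

theorem scalarSubgroup_smul (g : GammaL F V) (hg : g ∈ scalarSubgroup F V)
    (W : Submodule F V) : g • W = W := by
  obtain ⟨c, hc⟩ := hg
  apply SetLike.coe_injective
  rw [GammaL.coe_smul]
  ext v
  constructor
  · rintro ⟨x, hx, rfl⟩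
    rw [hc]
    exact W.smul_mem _ hx
  · intro hv
    refine ⟨(c⁻¹ : Fˣ).val • v, W.smul_mem _ hv, ?_⟩
    rw [hc, smul_smul, Units.mul_inv, one_smul]

/-- The induced action of `PΓL(V)` on the set of subspaces of `V`. -/
instance : MulAction (PGammaL F V) (Submodule F V) :=
  MulAction.compHom (Submodule F V)
    (QuotientGroup.lift (scalarSubgroup F V)
      (MulAction.toPermHom (GammaL F V) (Submodule F V))
      (fun g hg => Equiv.ext (scalarSubgroup_smul g hg)) :
        PGammaL F V →* Equiv.Perm (Submodule F V))

theorem PGammaL.mk_smul (g : GammaL F V) (W : Submodule F V) :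
    PGammaL.mk g • W = g • W := rfl

end Semilinear

/-! ### Attenuated spaces -/

section Attenuated

variable (F : Type*) [Field F] (n l : ℕ)

/-- The subspace `E` of `F^(n+l)` spanned by the last `l` standard basis vectors. -/
def subspaceE : Submodule F (Fin (n + l) → F) :=
  Submodule.span F (Set.range fun i : Fin l => Pi.single (Fin.natAdd n i) (1 : F))

/-- The set `X_m` of all subspaces of type `(m, 0)`: `m`-dimensional subspaces `P` with
`dim (P ∩ E) = 0`. -/
def attX (m : ℕ) : Set (Submodule F (Fin (n + l) → F)) :=
  {P | Module.finrank F P = m ∧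
    Module.finrank F (P ⊓ subspaceE F n l : Submodule F (Fin (n + l) → F)) = 0}

variable {F n l}

/-- The row space `P'` of the first `n` columns of a matrix representing `P`, i.e. the image of
`P` under the projection of `F^(n+l)` to the first `n` coordinates. -/
def firstPart (P : Submodule F (Fin (n + l) → F)) : Submodule F (Fin n → F) :=
  P.map (LinearMap.funLeft F F (Fin.castAdd l))

/-- The relation `R_{i,k}` on `X_m`: `dim (P' ∩ Q') = m - i` and `dim (P ∩ Q) = m - (i + k)`. -/
def attRel (m i k : ℕ) (P Q : attX F n l m) : Prop :=
  Module.finrank F (firstPart P.1 ⊓ firstPart Q.1 : Submodule F (Fin n → F)) + i = m ∧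
  Module.finrank F (P.1 ⊓ Q.1 : Submodule F (Fin (n + l) → F)) + (i + k) = m

variable (F n l)

/-- The graph `Γ^(m) = (X_m, R_{1,0})`. -/
def attGraph (m : ℕ) : SimpleGraph (attX F n l m) where
  Adj := attRel m 1 0
  symm := ⟨fun P Q h => by
    unfold attRel at h ⊢
    rwa [inf_comm, inf_comm Q.1 P.1]⟩
  loopless := ⟨fun P h => by
    have h1 := h.2
    rw [inf_idem, P.2.1] at h1
    omega⟩

/-- `PΓL(n+l, F)_E`: the stabilizer of the subspace `E` in `PΓL(F^(n+l))`. -/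
abbrev PGammaLStabE : Subgroup (PGammaL F (Fin (n + l) → F)) :=
  MulAction.stabilizer (PGammaL F (Fin (n + l) → F)) (subspaceE F n l)

end Attenuated

/-! Call a subspace meeting `E` trivially a transversal, and put m = k + 1. Rank-nullity for the
projection with kernel `E` merges the two dimension conditions into one: P and Q are adjacent iff P
+ Q is again a transversal, of dimension m + 1 (`attGraph_adj_iff`). The geometry of transversals
can be recovered from this graph.

Distinct non-adjacent P and Q satisfy dim(P ∩ Q) = k exactly when their common neighbours contain a
K₄ minus an edge (`exists_diamond`, `finrank_inf_of_diamond`). So "dim(P ∩ Q) = k" is a graph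
property. Every k-dimensional transversal U is P ∩ S for some non-adjacent P and S, and T contains U
iff T equals, or meets in dimension k, each common neighbour of P and S (`mem_star_iff`).
Automorphisms therefore permute the stars {T | U ≤ T} and induce an incidence-preserving permutation
in dimension k, itself a graph automorphism (`IsTransversalAut.exists_descent`,
`IsTransversalAut.of_incidence`).

Descending to dimension 1 leaves a collineation of the points off `E` and the lines disjoint from
`E`. Since `E` has codimension n ≥ 4, it is induced by a semilinear map
(`IsCollineationOff.exists_gammaL`), and incidence carries that map back up to dimension m
(`eq_smul_of_incidence`).

The action is faithful because a map fixing all m-dimensional transversals fixes their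
intersections, hence all points off `E`, and is then a scalar. -/

/-! ### Subspaces disjoint from a fixed subspace -/

section Transversal

open Module Submodule

variable {F V : Type*} [Field F] [AddCommGroup V] [Module F V]

/-- The `m`-dimensional subspaces that meet `E` trivially. -/
def transversals (E : Submodule F V) (m : ℕ) : Set (Submodule F V) :=
  {P | finrank F P = m ∧ Disjoint P E}

theorem exists_notMem_of_finrank_lt [FiniteDimensional F V] {W : Submodule F V}
    (h : finrank F W < finrank F V) : ∃ x, x ∉ W := by
  by_contra! hx
  rw [(eq_top_iff'.2 hx : W = ⊤), finrank_top] at h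
  exact lt_irrefl _ h

theorem finrank_sup_span_singleton_le [FiniteDimensional F V] (W : Submodule F V) (x : V) :
    finrank F (W ⊔ span F {x} : Submodule F V) ≤ finrank F W + 1 := by
  by_cases hx : x ∈ W
  · rw [sup_eq_left.2 ((span_singleton_le_iff_mem _ _).2 hx)]
    omega
  · exact (finrank_sup_span_singleton hx).le

theorem mem_sup_span_singleton_iff {W : Submodule F V} {x y : V} :
    y ∈ W ⊔ span F {x} ↔ ∃ c : F, y - c • x ∈ W := by
  rw [mem_sup]
  constructor
  · rintro ⟨w, hw, _, hz, rfl⟩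
    obtain ⟨c, rfl⟩ := mem_span_singleton.1 hz
    exact ⟨c, by simpa using hw⟩
  · rintro ⟨c, hc⟩
    exact ⟨_, hc, c • x, smul_mem _ _ (mem_span_singleton_self x), by simp⟩

/-- Steinitz exchange in the quotient by `H`. -/
theorem notMem_sup_span_symm {H : Submodule F V} {x y : V} (hx : x ∉ H)
    (hy : y ∉ H ⊔ span F {x}) : x ∉ H ⊔ span F {y} := by
  intro h
  obtain ⟨d, hd⟩ := mem_sup_span_singleton_iff.1 h
  by_cases hd0 : d = 0
  · subst hd0
    exact hx (by simpa using hd)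
  · apply hy
    have : d • y ∈ H ⊔ span F {x} := by
      have := sub_mem (mem_sup_right (mem_span_singleton_self x) : x ∈ H ⊔ span F {x})
        (mem_sup_left hd)
      simpa using this
    simpa [hd0] using smul_mem _ d⁻¹ this

variable {E P Q U : Submodule F V} {k m : ℕ}

theorem notMem_sup_of_mem (hP : P ∈ transversals E m) (hUP : U ≤ P) {x : V} (hx : x ∈ P)
    (hxU : x ∉ U) : x ∉ U ⊔ E := by
  intro h
  obtain ⟨u, hu, e, he, rfl⟩ := mem_sup.1 h
  have : e ∈ P := by simpa using P.sub_mem hx (hUP hu)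
  have h0 := disjoint_def.1 hP.2 e this he
  simp [h0, hu] at hxU

theorem transversals_of_le (hP : P ∈ transversals E m) (hU : U ≤ P) (h : finrank F U = k) :
    U ∈ transversals E k :=
  ⟨h, hP.2.mono_left hU⟩

variable [FiniteDimensional F V]

theorem sup_span_mem_transversals (hU : U ∈ transversals E k) {x : V} (hx : x ∉ U ⊔ E) :
    U ⊔ span F {x} ∈ transversals E (k + 1) := by
  have hxU : x ∉ U := fun h => hx (mem_sup_left h)
  refine ⟨by rw [finrank_sup_span_singleton hxU, hU.1], ?_⟩
  rw [disjoint_def]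
  intro y hy hyE
  obtain ⟨c, hc⟩ := mem_sup_span_singleton_iff.1 hy
  by_cases h0 : c = 0
  · subst h0
    exact disjoint_def.1 hU.2 y (by simpa using hc) hyE
  · exfalso
    apply hx
    have : c • x ∈ U ⊔ E := by
      have := sub_mem (mem_sup_right hyE : y ∈ U ⊔ E) (mem_sup_left hc)
      simpa using this
    simpa [h0] using (U ⊔ E).smul_mem c⁻¹ this

theorem eq_of_le_of_mem_transversals (hP : P ∈ transversals E m) (hQ : Q ∈ transversals E m)
    (h : P ≤ Q) : P = Q :=
  eq_of_le_of_finrank_eq h (hP.1.trans hQ.1.symm)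

theorem lt_finrank_sup (hP : P ∈ transversals E m) (hQ : Q ∈ transversals E m) (h : P ≠ Q) :
    m + 1 ≤ finrank F (P ⊔ Q : Submodule F V) := by
  have : P < P ⊔ Q := left_lt_sup.2 fun h' => h (eq_of_le_of_mem_transversals hQ hP h').symm
  simpa [hP.1] using finrank_lt_finrank_of_lt this

/-- Expresses adjacency through incidence alone, so that incidence-preserving bijections transport
it. -/
theorem sup_mem_transversals_iff (hP : P ∈ transversals E m) (hQ : Q ∈ transversals E m) :
    P ⊔ Q ∈ transversals E (m + 1) ↔ P ≠ Q ∧ ∃ W ∈ transversals E (m + 1), P ≤ W ∧ Q ≤ W := by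
  constructor
  · intro h
    refine ⟨?_, _, h, le_sup_left, le_sup_right⟩
    rintro rfl
    have := h.1
    rw [sup_idem, hP.1] at this
    omega
  · rintro ⟨hne, W, hW, hPW, hQW⟩
    have h1 := lt_finrank_sup hP hQ hne
    have h2 := finrank_mono (sup_le hPW hQW)
    rw [hW.1] at h2
    exact transversals_of_le hW (sup_le hPW hQW) (by omega)

/-- Two members of a star `{P | U ≤ P}` meet in `U`. -/
theorem inf_eq_of_le (hU : U ∈ transversals E k) (hP : P ∈ transversals E (k + 1))
    (hQ : Q ∈ transversals E (k + 1)) (hne : P ≠ Q) (hUP : U ≤ P) (hUQ : U ≤ Q) : P ⊓ Q = U := by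
  have h1 := lt_finrank_sup hP hQ hne
  have h2 := finrank_sup_add_finrank_inf_eq P Q
  rw [hP.1, hQ.1] at h2
  have h3 := hU.1
  exact (eq_of_le_of_finrank_le (le_inf hUP hUQ) (by omega)).symm

theorem finrank_inf_of_sup_mem (hP : P ∈ transversals E (k + 1)) (hQ : Q ∈ transversals E (k + 1))
    (h : P ⊔ Q ∈ transversals E (k + 2)) : finrank F (P ⊓ Q : Submodule F V) = k := by
  have h2 := finrank_sup_add_finrank_inf_eq P Q
  rw [hP.1, hQ.1, h.1] at h2
  omega

theorem exists_le_finrank_eq (A P : Submodule F V) (hAP : A ≤ P) (j : ℕ) (h1 : finrank F A ≤ j)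
    (h2 : j ≤ finrank F P) : ∃ B, A ≤ B ∧ B ≤ P ∧ finrank F B = j := by
  induction j, h1 using Nat.le_induction with
  | base => exact ⟨A, le_rfl, hAP, rfl⟩
  | succ j hj ih =>
    obtain ⟨B, hAB, hBP, hB⟩ := ih (by omega)
    have : B < P := lt_of_le_of_ne hBP fun h => by subst h; omega
    obtain ⟨x, hxP, hxB⟩ := SetLike.exists_of_lt this
    refine ⟨B ⊔ span F {x}, hAB.trans le_sup_left,
      sup_le hBP ((span_singleton_le_iff_mem _ _).2 hxP), ?_⟩
    rw [finrank_sup_span_singleton hxB, hB]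

/-- In the star of `U`, lines independent modulo `U + E` give adjacent members. -/
theorem sup_span_sup_mem (hU : U ∈ transversals E k) {x y : V} (hx : x ∉ U ⊔ E)
    (hy : y ∉ U ⊔ E ⊔ span F {x}) :
    (U ⊔ span F {x}) ⊔ (U ⊔ span F {y}) ∈ transversals E (k + 2) := by
  have h := sup_span_mem_transversals (sup_span_mem_transversals hU hx) (x := y)
    (by rwa [sup_right_comm])
  have e : U ⊔ span F {x} ⊔ (U ⊔ span F {y}) = U ⊔ span F {x} ⊔ span F {y} := by
    rw [← sup_assoc, sup_right_comm U, sup_idem]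
  rwa [e]

theorem exists_eq_sup_span (hU : U ∈ transversals E k) (hP : P ∈ transversals E (k + 1))
    (h : U ≤ P) : ∃ x, x ∉ U ⊔ E ∧ P = U ⊔ span F {x} := by
  have hlt : U < P := lt_of_le_of_ne h fun e => by
    have := hU.1; have := hP.1; subst e; omega
  obtain ⟨x, hxP, hxU⟩ := SetLike.exists_of_lt hlt
  have hx := notMem_sup_of_mem hP h hxP hxU
  exact ⟨x, hx, (eq_of_le_of_mem_transversals (sup_span_mem_transversals hU hx) hP
    (sup_le h ((span_singleton_le_iff_mem _ _).2 hxP))).symm⟩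

theorem span_singleton_mem_transversals {v : V} (hv : v ∉ E) :
    span F {v} ∈ transversals E 1 := by
  have := sup_span_mem_transversals (E := E) (U := ⊥) (k := 0)
    ⟨finrank_bot F V, disjoint_bot_left⟩ (x := v) (by rwa [bot_sup_eq])
  rwa [bot_sup_eq] at this

theorem exists_eq_span_singleton {P : Submodule F V} (hP : P ∈ transversals E 1) :
    ∃ x, x ∉ E ∧ P = span F {x} := by
  have := exists_eq_sup_span (E := E) (U := ⊥) (k := 0)
    ⟨finrank_bot F V, disjoint_bot_left⟩ hP bot_le
  simpa only [bot_sup_eq] using this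

/-- Every `U` is the intersection of two non-adjacent members of its star. -/
theorem exists_inf_eq (hE : E ≠ ⊥) (hU : U ∈ transversals E k)
    (h : k + 1 + finrank F E ≤ finrank F V) :
    ∃ P ∈ transversals E (k + 1), ∃ S ∈ transversals E (k + 1), P ≠ S ∧
      P ⊔ S ∉ transversals E (k + 2) ∧ P ⊓ S = U := by
  have h0 := finrank_add_le_finrank_add_finrank U E
  rw [hU.1] at h0
  obtain ⟨x, hx⟩ := exists_notMem_of_finrank_lt (W := U ⊔ E) (by omega)
  -- The members through x and x + e differ by e ∈ `E`, so their sum contains e and is not a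
  -- transversal.
  obtain ⟨e, he, he0⟩ := exists_mem_ne_zero_of_ne_bot hE
  have hxe : x + e ∉ U ⊔ E := by
    rwa [Submodule.add_mem_iff_left _ (mem_sup_right he)]
  have hP := sup_span_mem_transversals hU hx
  have hS := sup_span_mem_transversals hU hxe
  have hmem : e ∈ U ⊔ span F {x} ⊔ (U ⊔ span F {x + e}) := by
    have h1 : x + e ∈ U ⊔ span F {x} ⊔ (U ⊔ span F {x + e}) :=
      mem_sup_right (mem_sup_right (mem_span_singleton_self _))
    have h2 : x ∈ U ⊔ span F {x} ⊔ (U ⊔ span F {x + e}) :=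
      mem_sup_left (mem_sup_right (mem_span_singleton_self _))
    simpa using sub_mem h1 h2
  have hne : U ⊔ span F {x} ≠ U ⊔ span F {x + e} := by
    intro heq
    rw [← heq, sup_idem] at hmem
    exact he0 (disjoint_def.1 hP.2 e hmem he)
  exact ⟨_, hP, _, hS, hne, fun h => he0 (disjoint_def.1 h.2 e hmem he),
    inf_eq_of_le hU hP hS hne le_sup_left le_sup_left⟩

end Transversal

/-! ### Automorphisms preserve intersection dimensions and stars -/

section Star

open Module Submodule

variable {F V : Type*} [Field F] [AddCommGroup V] [Module F V] [FiniteDimensional F V]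
  {E P Q R S T U A B : Submodule F V} {k m : ℕ}

theorem sup_eq_of_finrank (hA : A ≤ P) (hB : B ≤ P) (hP : finrank F P = k + 1)
    (hAk : finrank F A = k) (hBk : finrank F B = k) (hne : A ≠ B) : A ⊔ B = P := by
  refine eq_of_le_of_finrank_le (sup_le hA hB) ?_
  have : A < A ⊔ B :=
    left_lt_sup.2 fun h => hne (eq_of_le_of_finrank_eq h (hBk.trans hAk.symm)).symm
  have := finrank_lt_finrank_of_lt this
  omega

/-- With U = P ∩ Q, take U + ⟨z⟩ for z = x, y, x + y, x + y + e, where x and y are independent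
modulo U + E + P and 0 ≠ e ∈ E. Only the last two are non-adjacent, because their sum contains e. -/
theorem exists_diamond (hE : E ≠ ⊥) (hn : k + 3 + finrank F E ≤ finrank F V)
    (hP : P ∈ transversals E (k + 1)) (hQ : Q ∈ transversals E (k + 1))
    (hadj : P ⊔ Q ∉ transversals E (k + 2))
    (h : finrank F (P ⊓ Q : Submodule F V) = k) :
    ∃ R : Fin 4 → transversals E (k + 1),
      (∀ i, (R i).1 ⊔ P ∈ transversals E (k + 2) ∧ (R i).1 ⊔ Q ∈ transversals E (k + 2)) ∧
      (R 0).1 ⊔ (R 1).1 ∈ transversals E (k + 2) ∧ (R 0).1 ⊔ (R 2).1 ∈ transversals E (k + 2) ∧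
      (R 0).1 ⊔ (R 3).1 ∈ transversals E (k + 2) ∧ (R 1).1 ⊔ (R 2).1 ∈ transversals E (k + 2) ∧
      (R 1).1 ⊔ (R 3).1 ∈ transversals E (k + 2) ∧ R 2 ≠ R 3 ∧
      (R 2).1 ⊔ (R 3).1 ∉ transversals E (k + 2) := by
  have hU := transversals_of_le hP inf_le_left h
  obtain ⟨p, hp, hPp⟩ := exists_eq_sup_span hU hP inf_le_left
  obtain ⟨q, hq, hQq⟩ := exists_eq_sup_span hU hQ inf_le_right
  set U := P ⊓ Q with hUdef
  -- Non-adjacency makes q dependent on p modulo U + E, so a vector avoiding U + E + ⟨p⟩ also avoids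
  -- U + E + ⟨q⟩.
  have hqp : q ∈ U ⊔ E ⊔ span F {p} := by
    by_contra hq'
    exact hadj (by rw [hPp, hQq]; exact sup_span_sup_mem hU hp hq')
  have hpq : U ⊔ E ⊔ span F {q} ≤ U ⊔ E ⊔ span F {p} :=
    sup_le le_sup_left ((span_singleton_le_iff_mem _ _).2 hqp)
  set N := U ⊔ E with hN
  have d0 : finrank F N ≤ k + finrank F E := by
    have := finrank_add_le_finrank_add_finrank U E
    rwa [hU.1] at this
  have d1 := finrank_sup_span_singleton_le N p
  obtain ⟨x, hx⟩ := exists_notMem_of_finrank_lt (W := N ⊔ span F {p}) (by omega)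
  have d2 := finrank_sup_span_singleton_le (N ⊔ span F {p}) x
  obtain ⟨y, hy⟩ := exists_notMem_of_finrank_lt (W := N ⊔ span F {p} ⊔ span F {x}) (by omega)
  obtain ⟨e, he, he0⟩ := exists_mem_ne_zero_of_ne_bot hE
  have heN : e ∈ N := mem_sup_right he
  have hxm : x ∈ N ⊔ span F {x} := mem_sup_right (mem_span_singleton_self x)
  have hym : y ∈ N ⊔ span F {y} := mem_sup_right (mem_span_singleton_self y)
  have i1 : N ⊔ span F {p} ≤ N ⊔ span F {p} ⊔ span F {x} := le_sup_left
  have i2 : N ⊔ span F {x} ≤ N ⊔ span F {p} ⊔ span F {x} := sup_le_sup_right le_sup_left _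
  have hyp : y ∉ N ⊔ span F {p} := fun h => hy (i1 h)
  have hyx : y ∉ N ⊔ span F {x} := fun h => hy (i2 h)
  have hxy : x ∉ N ⊔ span F {y} := notMem_sup_span_symm (fun h => hx (mem_sup_left h)) hyx
  have hzp : x + y ∉ N ⊔ span F {p} := fun h => hy (by
    have := sub_mem (i1 h) (i2 hxm)
    simpa using this)
  have hzx : x + y ∉ N ⊔ span F {x} := by rwa [Submodule.add_mem_iff_right _ hxm]
  have hzy : x + y ∉ N ⊔ span F {y} := by rwa [Submodule.add_mem_iff_left _ hym]
  have hwp : x + y + e ∉ N ⊔ span F {p} := by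
    rwa [Submodule.add_mem_iff_left _ (mem_sup_left heN)]
  have hwx : x + y + e ∉ N ⊔ span F {x} := by
    rwa [Submodule.add_mem_iff_left _ (mem_sup_left heN)]
  have hwy : x + y + e ∉ N ⊔ span F {y} := by
    rwa [Submodule.add_mem_iff_left _ (mem_sup_left heN)]
  have aux : ∀ z : V, z ∉ N ⊔ span F {p} → z ∉ N := fun z hz h => hz (mem_sup_left h)
  have hPQ : ∀ z : V, z ∉ N ⊔ span F {p} → U ⊔ span F {z} ⊔ P ∈ transversals E (k + 2) ∧
      U ⊔ span F {z} ⊔ Q ∈ transversals E (k + 2) := by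
    intro z hz
    rw [hPp, hQq, sup_comm, sup_comm _ (U ⊔ span F {q})]
    exact ⟨sup_span_sup_mem hU hp hz, sup_span_sup_mem hU hq fun h => hz (hpq h)⟩
  have hmem : e ∈ U ⊔ span F {x + y} ⊔ (U ⊔ span F {x + y + e}) := by
    have h1 : x + y + e ∈ U ⊔ span F {x + y} ⊔ (U ⊔ span F {x + y + e}) :=
      mem_sup_right (mem_sup_right (mem_span_singleton_self _))
    have h2 : x + y ∈ U ⊔ span F {x + y} ⊔ (U ⊔ span F {x + y + e}) :=
      mem_sup_left (mem_sup_right (mem_span_singleton_self _))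
    simpa using sub_mem h1 h2
  refine ⟨![⟨_, sup_span_mem_transversals hU (aux x hx)⟩,
    ⟨_, sup_span_mem_transversals hU (aux y hyp)⟩,
    ⟨_, sup_span_mem_transversals hU (aux _ hzp)⟩,
    ⟨_, sup_span_mem_transversals hU (aux _ hwp)⟩], ?_, ?_, ?_, ?_, ?_, ?_, ?_, ?_⟩
  · intro i
    fin_cases i
    · exact hPQ x hx
    · exact hPQ y hyp
    · exact hPQ _ hzp
    · exact hPQ _ hwp
  · exact sup_span_sup_mem hU (aux x hx) hyx
  · exact sup_span_sup_mem hU (aux x hx) hzx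
  · exact sup_span_sup_mem hU (aux x hx) hwx
  · exact sup_span_sup_mem hU (aux y hyp) hzy
  · exact sup_span_sup_mem hU (aux y hyp) hwy
  · intro heq
    have heq' : U ⊔ span F {x + y} = U ⊔ span F {x + y + e} := congrArg Subtype.val heq
    rw [← heq', sup_idem] at hmem
    exact he0 (disjoint_def.1 (sup_span_mem_transversals hU (aux _ hzp)).2 e hmem he)
  · exact fun h => he0 (disjoint_def.1 h.2 e hmem he)

/-- If `P ⊓ Q` has codimension two, adjacent common neighbours of `P` and `Q` agree on `P` or on
`Q`. -/
theorem inf_eq_or_inf_eq (hP : P ∈ transversals E (k + 1)) (hQ : Q ∈ transversals E (k + 1))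
    (h : finrank F (P ⊓ Q : Submodule F V) < k)
    (hRP : finrank F (R ⊓ P : Submodule F V) = k) (hRQ : finrank F (R ⊓ Q : Submodule F V) = k)
    (hSP : finrank F (S ⊓ P : Submodule F V) = k) (hSQ : finrank F (S ⊓ Q : Submodule F V) = k)
    (hRS : R ⊔ S ∈ transversals E (k + 2)) : R ⊓ P = S ⊓ P ∨ R ⊓ Q = S ⊓ Q := by
  by_contra! hne
  have h1 := sup_eq_of_finrank inf_le_right inf_le_right hP.1 hRP hSP hne.1
  have h2 := sup_eq_of_finrank inf_le_right inf_le_right hQ.1 hRQ hSQ hne.2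
  -- Distinct traces generate P and Q, so P + Q, of dimension at least k + 3, would fit into R + S,
  -- of dimension k + 2.
  have h3 : P ⊔ Q ≤ R ⊔ S := by
    rw [← h1, ← h2]
    exact sup_le (sup_le_sup inf_le_left inf_le_left) (sup_le_sup inf_le_left inf_le_left)
  have h4 := finrank_mono h3
  have h5 := finrank_sup_add_finrank_inf_eq P Q
  rw [hP.1, hQ.1] at h5
  rw [hRS.1] at h4
  omega

/-- Were the two hyperplanes of R equal, P ∩ Q would contain a k-dimensional space; being distinct,
they generate R. -/
theorem sup_inf_eq_of_finrank_lt (hR : R ∈ transversals E (k + 1))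
    (h : finrank F (P ⊓ Q : Submodule F V) < k)
    (hRP : finrank F (R ⊓ P : Submodule F V) = k) (hRQ : finrank F (R ⊓ Q : Submodule F V) = k) :
    (R ⊓ P) ⊔ (R ⊓ Q) = R := by
  refine sup_eq_of_finrank inf_le_left inf_le_left hR.1 hRP hRQ fun heq => ?_
  have : R ⊓ P ≤ P ⊓ Q := le_inf inf_le_right (heq ▸ inf_le_right)
  have := finrank_mono this
  omega

/-- A diamond among the common neighbours of `P` and `Q` forces `P ⊓ Q` to be a hyperplane of
both. -/
theorem finrank_inf_of_diamond
    (hP : P ∈ transversals E (k + 1)) (hQ : Q ∈ transversals E (k + 1)) (hne : P ≠ Q)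
    (R : Fin 4 → transversals E (k + 1))
    (hR : ∀ i, (R i).1 ⊔ P ∈ transversals E (k + 2) ∧ (R i).1 ⊔ Q ∈ transversals E (k + 2))
    (h01 : (R 0).1 ⊔ (R 1).1 ∈ transversals E (k + 2))
    (h02 : (R 0).1 ⊔ (R 2).1 ∈ transversals E (k + 2))
    (h03 : (R 0).1 ⊔ (R 3).1 ∈ transversals E (k + 2))
    (h12 : (R 1).1 ⊔ (R 2).1 ∈ transversals E (k + 2))
    (h13 : (R 1).1 ⊔ (R 3).1 ∈ transversals E (k + 2))
    (hne' : R 2 ≠ R 3) (h23 : (R 2).1 ⊔ (R 3).1 ∉ transversals E (k + 2)) :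
    finrank F (P ⊓ Q : Submodule F V) = k := by
  have hle : finrank F (P ⊓ Q : Submodule F V) ≤ k := by
    have h1 := lt_finrank_sup hP hQ hne
    have h5 := finrank_sup_add_finrank_inf_eq P Q
    rw [hP.1, hQ.1] at h5
    omega
  by_contra hcon
  have hlt : finrank F (P ⊓ Q : Submodule F V) < k := lt_of_le_of_ne hle hcon
  have fP : ∀ i, finrank F ((R i).1 ⊓ P : Submodule F V) = k := fun i =>
    finrank_inf_of_sup_mem (R i).2 hP (hR i).1
  have fQ : ∀ i, finrank F ((R i).1 ⊓ Q : Submodule F V) = k := fun i =>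
    finrank_inf_of_sup_mem (R i).2 hQ (hR i).2
  have hdec : ∀ i, ((R i).1 ⊓ P) ⊔ ((R i).1 ⊓ Q) = (R i).1 := fun i =>
    sup_inf_eq_of_finrank_lt (R i).2 hlt (fP i) (fQ i)
  have hor : ∀ i j, (R i).1 ⊔ (R j).1 ∈ transversals E (k + 2) →
      (R i).1 ⊓ P = (R j).1 ⊓ P ∨ (R i).1 ⊓ Q = (R j).1 ⊓ Q := fun i j hij =>
    inf_eq_or_inf_eq hP hQ hlt (fP i) (fQ i) (fP j) (fQ j) hij
  have hn01 : (R 0).1 ≠ (R 1).1 := ((sup_mem_transversals_iff (R 0).2 (R 1).2).1 h01).1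
  have key : (R 2).1 ≤ (R 0).1 ⊔ (R 1).1 ∧ (R 3).1 ≤ (R 0).1 ⊔ (R 1).1 := by
    -- If R₀ and R₁ share their trace on A, then so does R_j: otherwise R_j would share its trace on
    -- B with both, forcing R₀ = R₁. The traces of R₀ and R₁ on B generate B, so R_j ≤ R₀ + R₁.
    have main : ∀ A B : Submodule F V, A ∈ transversals E (k + 1) → B ∈ transversals E (k + 1) →
        (∀ i, finrank F ((R i).1 ⊓ B : Submodule F V) = k) →
        (∀ i, ((R i).1 ⊓ A) ⊔ ((R i).1 ⊓ B) = (R i).1) →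
        (∀ i j, (R i).1 ⊔ (R j).1 ∈ transversals E (k + 2) →
          (R i).1 ⊓ A = (R j).1 ⊓ A ∨ (R i).1 ⊓ B = (R j).1 ⊓ B) →
        (R 0).1 ⊓ A = (R 1).1 ⊓ A → ∀ j, (R 0).1 ⊔ (R j).1 ∈ transversals E (k + 2) →
        (R 1).1 ⊔ (R j).1 ∈ transversals E (k + 2) → (R j).1 ≤ (R 0).1 ⊔ (R 1).1 := by
      intro A B hA hB fB dec or' h j h0j h1j
      have hnB : (R 0).1 ⊓ B ≠ (R 1).1 ⊓ B := fun h' => hn01 (by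
        rw [← dec 0, ← dec 1, h, h'])
      have hA' : (R 0).1 ⊓ A = (R j).1 ⊓ A := by
        rcases or' 0 j h0j with h' | h'
        · exact h'
        · rcases or' 1 j h1j with h'' | h''
          · exact h.trans h''
          · exact absurd (h'.trans h''.symm) hnB
      have hB' := sup_eq_of_finrank inf_le_right inf_le_right hB.1 (fB 0) (fB 1) hnB
      rw [← dec j, ← hA']
      refine sup_le (inf_le_left.trans le_sup_left) (inf_le_right.trans ?_)
      rw [← hB']
      exact sup_le_sup inf_le_left inf_le_left
    rcases hor 0 1 h01 with h | h
    · exact ⟨main P Q hP hQ fQ hdec hor h 2 h02 h12, main P Q hP hQ fQ hdec hor h 3 h03 h13⟩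
    · have hdec' : ∀ i, ((R i).1 ⊓ Q) ⊔ ((R i).1 ⊓ P) = (R i).1 := fun i => by
        rw [sup_comm, hdec]
      have hor' := fun i j hij => (hor i j hij).symm
      exact ⟨main Q P hQ hP fP hdec' hor' h 2 h02 h12, main Q P hQ hP fP hdec' hor' h 3 h03 h13⟩
  exact h23 ((sup_mem_transversals_iff (R 2).2 (R 3).2).2
    ⟨fun h => hne' (Subtype.ext h), _, h01, key.1, key.2⟩)

/-- If R ∩ P and R ∩ S differ, they generate R, so R ≤ P + S; then R + P = P + S by dimension, and P
and S would be adjacent. So the traces agree and equal P ∩ S. -/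
theorem le_of_common_neighbor (hP : P ∈ transversals E (k + 1)) (hS : S ∈ transversals E (k + 1))
    (hadj : P ⊔ S ∉ transversals E (k + 2))
    (hU : finrank F (P ⊓ S : Submodule F V) = k) (hR : R ∈ transversals E (k + 1))
    (hRP : R ⊔ P ∈ transversals E (k + 2)) (hRS : R ⊔ S ∈ transversals E (k + 2)) :
    P ⊓ S ≤ R := by
  have fP := finrank_inf_of_sup_mem hR hP hRP
  have fS := finrank_inf_of_sup_mem hR hS hRS
  by_cases heq : R ⊓ P = R ⊓ S
  · have h1 : R ⊓ P ≤ P ⊓ S := le_inf inf_le_right (heq ▸ inf_le_right)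
    rw [← eq_of_le_of_finrank_eq h1 (fP.trans hU.symm)]
    exact inf_le_left
  · exfalso
    apply hadj
    have h1 := sup_eq_of_finrank inf_le_left inf_le_left hR.1 fP fS heq
    have h2 : R ⊔ P ≤ P ⊔ S := by
      refine sup_le ?_ le_sup_left
      rw [← h1]
      exact sup_le_sup inf_le_right inf_le_right
    have h3 := finrank_sup_add_finrank_inf_eq P S
    rw [hP.1, hS.1, hU] at h3
    rw [← eq_of_le_of_finrank_eq h2 (by rw [hRP.1]; omega)]
    exact hRP

/-- Common neighbours of P and S all contain U = P ∩ S, which gives one direction. Conversely, if T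
misses part of U, testing T against all neighbours U + ⟨x⟩ forces T + U = V, which the dimension
bound excludes. -/
theorem mem_star_iff (hn : k + 3 + finrank F E ≤ finrank F V)
    (hP : P ∈ transversals E (k + 1)) (hS : S ∈ transversals E (k + 1))
    (hadj : P ⊔ S ∉ transversals E (k + 2))
    (hU : finrank F (P ⊓ S : Submodule F V) = k) (hT : T ∈ transversals E (k + 1)) :
    P ⊓ S ≤ T ↔ ∀ R ∈ transversals E (k + 1), R ⊔ P ∈ transversals E (k + 2) →
      R ⊔ S ∈ transversals E (k + 2) → T = R ∨ finrank F (T ⊓ R : Submodule F V) = k := by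
  have hUX := transversals_of_le hP inf_le_left hU
  constructor
  · intro h R hR hRP hRS
    by_cases hTR : T = R
    · exact Or.inl hTR
    · right
      rw [inf_eq_of_le hUX hT hR hTR h (le_of_common_neighbor hP hS hadj hU hR hRP hRS), hU]
  · intro h
    by_contra hUT
    obtain ⟨p, hp, hPp⟩ := exists_eq_sup_span hUX hP inf_le_left
    obtain ⟨s, hs, hSs⟩ := exists_eq_sup_span hUX hS inf_le_right
    set U := P ⊓ S with hUdef
    have hsp : s ∈ U ⊔ E ⊔ span F {p} := by
      by_contra h'
      exact hadj (by rw [hPp, hSs]; exact sup_span_sup_mem hUX hp h')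
    have hps : U ⊔ E ⊔ span F {s} ≤ U ⊔ E ⊔ span F {p} :=
      sup_le le_sup_left ((span_singleton_le_iff_mem _ _).2 hsp)
    set N := U ⊔ E with hN
    have hUT1 : finrank F (T ⊓ U : Submodule F V) < k := by
      have : T ⊓ U < U := inf_lt_right.2 hUT
      simpa [hU] using finrank_lt_finrank_of_lt this
    have hle : ∀ x, x ∉ N ⊔ span F {p} →
        k ≤ finrank F (T ⊓ (U ⊔ span F {x}) : Submodule F V) := by
      intro x hx
      have hxN : x ∉ N := fun h => hx (mem_sup_left h)
      have hRX := sup_span_mem_transversals hUX hxN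
      rcases h (U ⊔ span F {x}) hRX
        (by rw [hPp, sup_comm]; exact sup_span_sup_mem hUX hp hx)
        (by rw [hSs, sup_comm]; exact sup_span_sup_mem hUX hs fun h => hx (hps h)) with h' | h'
      · rw [← h', inf_idem, hT.1]
        omega
      · exact h'.ge
    -- T meets U + ⟨x⟩ in dimension at least k but U in less, so some vector of T has a nonzero
    -- x-coefficient.
    have hmem : ∀ x, x ∉ N ⊔ span F {p} → x ∈ T ⊔ U := by
      intro x hx
      have h1 : ¬ T ⊓ (U ⊔ span F {x}) ≤ U := by
        intro h'
        have := finrank_mono (le_inf inf_le_left h' : T ⊓ (U ⊔ span F {x}) ≤ T ⊓ U)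
        have := hle x hx
        omega
      obtain ⟨t, ⟨htT, ht⟩, htU⟩ := SetLike.not_le_iff_exists.1 h1
      obtain ⟨c, hc⟩ := mem_sup_span_singleton_iff.1 ht
      have h0 : c ≠ 0 := by
        rintro rfl
        exact htU (by simpa using hc)
      have : c • x ∈ T ⊔ U := by
        simpa using sub_mem (mem_sup_left htT : t ∈ T ⊔ U) (mem_sup_right hc)
      simpa [h0] using smul_mem _ c⁻¹ this
    have d0 : finrank F N ≤ k + finrank F E := by
      have := finrank_add_le_finrank_add_finrank U E
      rwa [hU] at this
    have d1 := finrank_sup_span_singleton_le N p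
    obtain ⟨x, hx⟩ := exists_notMem_of_finrank_lt (W := N ⊔ span F {p}) (by omega)
    have htop : T ⊔ U = ⊤ := by
      rw [eq_top_iff']
      intro z
      by_cases hz : z ∈ N ⊔ span F {p}
      · have h1 : z + x ∉ N ⊔ span F {p} := by rwa [Submodule.add_mem_iff_right _ hz]
        simpa using sub_mem (hmem _ h1) (hmem _ hx)
      · exact hmem z hz
    -- T + U = V gives dim(T ∩ U) ≤ k − 2 − dim E, and enlarging U by ⟨x⟩ adds at most one: too
    -- little for `hle`.
    have h1 := finrank_sup_add_finrank_inf_eq T U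
    rw [htop, finrank_top, hT.1, hU] at h1
    have h2 := finrank_sup_add_finrank_inf_eq (T ⊓ (U ⊔ span F {x})) U
    have h3 : T ⊓ (U ⊔ span F {x}) ⊓ U = T ⊓ U := by
      rw [inf_assoc, inf_eq_right.2 (le_sup_left : U ≤ U ⊔ span F {x})]
    have h4 : finrank F (T ⊓ (U ⊔ span F {x}) ⊔ U : Submodule F V) ≤ k + 1 := by
      have := finrank_mono (sup_le inf_le_right le_sup_left :
        T ⊓ (U ⊔ span F {x}) ⊔ U ≤ U ⊔ span F {x})
      have := finrank_sup_span_singleton_le U x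
      omega
    rw [h3, hU] at h2
    have := hle x hx
    omega

end Star

/-! ### Reconstruction of a semilinear map from its action on points and lines -/

section Reconstruction

open Module Submodule

variable {F V V' : Type*} [Field F] [AddCommGroup V] [Module F V] [AddCommGroup V']

/-- Set G x = g (x + z) − g z for any z with z and x + z off `H`. Codimension three supplies a z
independent of any two given vectors modulo `H`, which makes this independent of z and additive. -/
theorem exists_addMonoidHom_extension [FiniteDimensional F V] (H : Submodule F V)
    (hH : finrank F H + 3 ≤ finrank F V) (g : V → V')
    (hg : ∀ x y, x ∉ H → y ∉ H ⊔ span F {x} → g (x + y) = g x + g y) :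
    ∃ G : V →+ V', ∀ x, x ∉ H → G x = g x := by
  have exz : ∀ x y : V, ∃ z, z ∉ H ⊔ span F {x} ⊔ span F {y} := fun x y =>
    exists_notMem_of_finrank_lt (by
      have := finrank_sup_span_singleton_le H x
      have := finrank_sup_span_singleton_le (H ⊔ span F {x}) y
      omega)
  have hself : ∀ x : V, x ∈ H ⊔ span F {x} := fun x =>
    mem_sup_right (mem_span_singleton_self x)
  have hle : ∀ x y : V, y ∈ H ⊔ span F {x} → H ⊔ span F {y} ≤ H ⊔ span F {x} := fun x y h =>
    sup_le le_sup_left ((span_singleton_le_iff_mem _ _).2 h)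
  have add1 : ∀ x y, x ∉ H → y ∉ H → x + y ∉ H → g (x + y) = g x + g y := by
    intro x y hx hy hxy
    by_cases h : y ∈ H ⊔ span F {x}
    · obtain ⟨z, hz⟩ := exz x x
      rw [sup_assoc, sup_idem] at hz
      have h1 : y + z ∉ H ⊔ span F {x} := by rwa [Submodule.add_mem_iff_right _ h]
      have h2 : z ∉ H ⊔ span F {y} := fun h' => hz (hle x y h h')
      have h3 : z ∉ H ⊔ span F {x + y} := fun h' => hz (hle x (x + y) (add_mem (hself x) h) h')
      have e1 := hg x (y + z) hx h1
      have e2 := hg y z hy h2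
      have e3 := hg (x + y) z hxy h3
      rw [add_assoc, e1, e2, ← add_assoc] at e3
      exact (add_right_cancel e3).symm
    · exact hg x y hx h
  have indep : ∀ x z w, z ∉ H → x + z ∉ H → w ∉ H → x + w ∉ H →
      g (x + z) - g z = g (x + w) - g w := by
    have direct : ∀ x z w, z ∉ H → x + z ∉ H → w ∉ H → x + w ∉ H → x + z + w ∉ H →
        g (x + z) - g z = g (x + w) - g w := by
      intro x z w hz hxz hw hxw h
      have e1 := add1 (x + z) w hxz hw h
      have e2 := add1 (x + w) z hxw hz (by rwa [add_right_comm])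
      rw [add_right_comm, e1] at e2
      rw [sub_eq_sub_iff_add_eq_add, e2]
    intro x z w hz hxz hw hxw
    -- If x + z + w falls into `H`, z and w are compared through a third vector u.
    by_cases h : x + z + w ∈ H
    · obtain ⟨u, hu⟩ := exz z w
      set M := H ⊔ span F {z} ⊔ span F {w} with hM
      have hHM : H ≤ M := le_sup_left.trans le_sup_left
      have hzM : z ∈ M := mem_sup_left (hself z)
      have hwM : w ∈ M := mem_sup_right (mem_span_singleton_self w)
      have hxM : x ∈ M := by
        have := sub_mem (sub_mem (hHM h) hwM) hzM
        simpa using this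
      have out : ∀ t ∈ M, t + u ∉ H := fun t ht h' => hu (by
        simpa using sub_mem (hHM h') ht)
      have hu0 : u ∉ H := fun h' => hu (hHM h')
      rw [direct x z u hz hxz hu0 (out x hxM) (out _ (add_mem hxM hzM)),
        direct x w u hw hxw hu0 (out x hxM) (out _ (add_mem hxM hwM))]
    · exact direct x z w hz hxz hw hxw h
  have exz1 : ∀ x, ∃ z, z ∉ H ⊔ span F {x} := fun x =>
    (exz x x).imp fun z hz => by rwa [sup_assoc, sup_idem] at hz
  choose ζ hζ using exz1
  have hζ0 : ∀ x, ζ x ∉ H := fun x h => hζ x (mem_sup_left h)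
  have hζ1 : ∀ x, x + ζ x ∉ H := fun x h => hζ x (by
    have := sub_mem (mem_sup_left h : _ ∈ H ⊔ span F {x}) (hself x)
    simpa using this)
  refine ⟨AddMonoidHom.mk' (fun x => g (x + ζ x) - g (ζ x)) fun x y => ?_, fun x hx => ?_⟩
  · obtain ⟨z, hz⟩ := exz x y
    set M := H ⊔ span F {x} ⊔ span F {y} with hM
    have hHM : H ≤ M := le_sup_left.trans le_sup_left
    have hxM : x ∈ M := mem_sup_left (hself x)
    have hyM : y ∈ M := mem_sup_right (mem_span_singleton_self y)
    have out : ∀ t ∈ M, t + z ∉ H := fun t ht h' => hz (by simpa using sub_mem (hHM h') ht)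
    have hz0 : z ∉ H := fun h' => hz (hHM h')
    have h1 := out _ (add_mem hyM hxM)
    rw [add_assoc] at h1
    -- Using z for x and x + z for y makes the two differences telescope.
    rw [indep (x + y) _ z (hζ0 _) (hζ1 _) hz0 (out _ (add_mem hxM hyM)),
      indep x _ z (hζ0 _) (hζ1 _) hz0 (out x hxM),
      indep y _ (x + z) (hζ0 _) (hζ1 _) (out x hxM) h1, add_comm x y, add_assoc]
    abel
  · simp only [AddMonoidHom.mk'_apply]
    rw [hg x (ζ x) hx (hζ x), add_sub_cancel_right]

/-- An additive map that, off a subspace `H` of codimension at least two, sends lines into lines and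
is injective on lines independent modulo `H`, is semilinear. -/
theorem exists_ringHom_of_addMonoidHom [Module F V'] [FiniteDimensional F V] (H : Submodule F V)
    (hH : finrank F H + 2 ≤ finrank F V) (G : V →+ V')
    (hG : ∀ x, x ∉ H → ∀ c : F, G (c • x) ∈ span F {G x}) (hG0 : ∀ x, x ∉ H → G x ≠ 0)
    (hind : ∀ x y, x ∉ H → y ∉ H ⊔ span F {x} → G y ∉ span F {G x}) :
    ∃ σ : F →+* F, ∀ (c : F) (v : V), G (c • v) = σ c • G v := by
  have exz : ∀ x : V, ∃ z, z ∉ H ⊔ span F {x} := fun x =>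
    exists_notMem_of_finrank_lt (by
      have := finrank_sup_span_singleton_le H x
      omega)
  -- The multiplier of x + y must agree with those of x and y, since G x and G y are independent.
  have cmp : ∀ x y, x ∉ H → y ∉ H ⊔ span F {x} → ∀ c s : F, G (c • x) = s • G x →
      G (c • y) = s • G y := by
    intro x y hx hy c s hs
    have hy0 : y ∉ H := fun h => hy (mem_sup_left h)
    have hxy : x + y ∉ H := fun h => hy (by
      have := sub_mem (mem_sup_left h : _ ∈ H ⊔ span F {x})
        (mem_sup_right (mem_span_singleton_self x))
      simpa using this)
    obtain ⟨t, ht⟩ := mem_span_singleton.1 (hG y hy0 c)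
    obtain ⟨r, hr⟩ := mem_span_singleton.1 (hG (x + y) hxy c)
    have e : (s - r) • G x + (t - r) • G y = 0 := by
      have : G (c • (x + y)) = s • G x + t • G y := by rw [smul_add, map_add, hs, ht]
      rw [← hr, map_add] at this
      linear_combination (norm := module) (-1 : F) • this
    have htr : t - r = 0 := by
      by_contra h0
      apply hind x y hx hy
      rw [mem_span_singleton]
      refine ⟨-((t - r)⁻¹ * (s - r)), ?_⟩
      have h1 : (t - r)⁻¹ • ((s - r) • G x + (t - r) • G y) = 0 := by rw [e, smul_zero]
      rw [smul_add, smul_smul, smul_smul, inv_mul_cancel₀ h0, one_smul] at h1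
      rw [neg_smul, eq_comm]
      exact eq_neg_of_add_eq_zero_right h1
    have hsr : s - r = 0 := by
      rw [htr, zero_smul, add_zero] at e
      exact (smul_eq_zero.1 e).resolve_right (hG0 x hx)
    rw [← ht, sub_eq_zero.1 htr, sub_eq_zero.1 hsr]
  obtain ⟨x₀, hx₀⟩ := exists_notMem_of_finrank_lt (W := H) (by omega)
  have hσ : ∀ c : F, ∃ s : F, G (c • x₀) = s • G x₀ := fun c =>
    (mem_span_singleton.1 (hG x₀ hx₀ c)).imp fun _ h => h.symm
  choose σ hσ using hσ
  have off : ∀ (c : F) (y : V), y ∉ H → G (c • y) = σ c • G y := by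
    intro c y hy
    by_cases h : y ∈ H ⊔ span F {x₀}
    · obtain ⟨z, hz⟩ := exz x₀
      have hz0 : z ∉ H := fun h => hz (mem_sup_left h)
      have hzy : z ∉ H ⊔ span F {y} := fun h' =>
        hz (sup_le le_sup_left ((span_singleton_le_iff_mem _ _).2 h) h')
      have hyz : y ∉ H ⊔ span F {z} := notMem_sup_span_symm hy hzy
      exact cmp z y hz0 hyz c _ (cmp x₀ z hx₀ hz c _ (hσ c))
    · exact cmp x₀ y hx₀ h c _ (hσ c)
  have all : ∀ (c : F) (y : V), G (c • y) = σ c • G y := by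
    intro c y
    by_cases hy : y ∈ H
    · have h1 : y + x₀ ∉ H := by rwa [Submodule.add_mem_iff_right _ hy]
      have e1 := off c _ h1
      rw [smul_add, map_add, map_add, smul_add, off c _ hx₀] at e1
      exact add_right_cancel e1
    · exact off c y hy
  have inj : ∀ a b : F, a • G x₀ = b • G x₀ → a = b := fun a b h =>
    smul_left_injective F (hG0 x₀ hx₀) h
  refine ⟨RingHom.mk' ⟨⟨σ, ?_⟩, fun a b => ?_⟩ fun a b => ?_, all⟩
  · exact inj _ _ (by rw [← all, one_smul, one_smul])
  · exact inj _ _ (by rw [← all, mul_smul, all, all, mul_smul])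
  · exact inj _ _ (by
      change σ (a + b) • G x₀ = (σ a + σ b) • G x₀
      rw [← all, add_smul, map_add, all, all, add_smul])

end Reconstruction

/-! ### Fundamental theorem of projective geometry relative to `E` -/

section Collineation

open Module Submodule

variable {F V : Type*} [Field F] [AddCommGroup V] [Module F V]

theorem span_pair_le_sup (H : Submodule F V) (x : V) {h : V} (hh : h ∈ H) :
    span F {x, h} ≤ H ⊔ span F {x} := by
  rw [span_le]
  rintro z (rfl | rfl)
  · exact mem_sup_right (mem_span_singleton_self z)
  · exact mem_sup_left hh

/-- A map that, on vectors outside `E`, preserves and reflects incidence of points outside `E` with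
lines disjoint from `E`. -/
structure IsCollineationOff (E : Submodule F V) (a : V → V) : Prop where
  notMem : ∀ {v}, v ∉ E → a v ∉ E
  point : ∀ {v z}, v ∉ E → z ∉ E → (a z ∈ span F {a v} ↔ z ∈ span F {v})
  line : ∀ {v w z}, v ∉ E → w ∉ E ⊔ span F {v} → z ∉ E →
    (a z ∈ span F {a v, a w} ↔ z ∈ span F {v, w})

namespace IsCollineationOff

variable {E : Submodule F V} {a : V → V}

/-- The normalization of the vector representing the image of the point `⟨x⟩`. -/
theorem exists_normalized (ha : IsCollineationOff E a) {v x : V} (hv : v ∉ E)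
    (hx : x ∉ E ⊔ span F {v}) :
    ∃ y, y ∈ span F {a x} ∧ a x ∈ span F {y} ∧ a (x + v) ∈ span F {a v + y} := by
  have hxE : x ∉ E := fun h => hx (mem_sup_left h)
  have hvm : v ∈ E ⊔ span F {v} := mem_sup_right (mem_span_singleton_self v)
  have hxv : x + v ∉ E := fun h => hx (by
    simpa using sub_mem (mem_sup_left h : _ ∈ E ⊔ span F {v}) hvm)
  have h1 : a (x + v) ∈ span F {a v, a x} := (ha.line hv hx hxv).2
    (add_mem (subset_span (by simp)) (subset_span (by simp)))
  obtain ⟨t, s, hts⟩ := mem_span_pair.1 h1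
  have ht : t ≠ 0 := by
    rintro rfl
    have h2 : x + v ∈ span F {x} := (ha.point hxE hxv).1 (by
      rw [← hts, zero_smul, zero_add]
      exact smul_mem _ _ (mem_span_singleton_self _))
    have h3 : v ∈ span F {x} := by simpa using sub_mem h2 (mem_span_singleton_self x)
    exact notMem_sup_span_symm hv hx (mem_sup_right h3)
  have hs : s ≠ 0 := by
    rintro rfl
    have h2 : x + v ∈ span F {v} := (ha.point hv hxv).1 (by
      rw [← hts, zero_smul, add_zero]
      exact smul_mem _ _ (mem_span_singleton_self _))
    have h3 : x ∈ span F {v} := by simpa using sub_mem h2 (mem_span_singleton_self v)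
    exact hx (mem_sup_right h3)
  refine ⟨(t⁻¹ * s) • a x, smul_mem _ _ (mem_span_singleton_self _), ?_, ?_⟩
  · refine mem_span_singleton.2 ⟨s⁻¹ * t, ?_⟩
    rw [smul_smul]
    have : s⁻¹ * t * (t⁻¹ * s) = 1 := by field_simp
    rw [this, one_smul]
  · refine mem_span_singleton.2 ⟨t, ?_⟩
    rw [smul_add, smul_smul, ← hts]
    have : t * (t⁻¹ * s) = s := by field_simp
    rw [this]

/-- With C = a v, the image of ⟨x + y + v⟩ lies on the lines ⟨C + A, B⟩ and ⟨A, C + B⟩, hence is ⟨A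
+ B + C⟩. The image of ⟨x + y⟩ lies on ⟨A, B⟩ and on ⟨C, A + B + C⟩, hence is ⟨A + B⟩; the
normalization of D fixes the scalar. -/
theorem normalized_add (ha : IsCollineationOff E a) {v x y A B D : V} (hv : v ∉ E)
    (hx : x ∉ E ⊔ span F {v}) (hy : y ∉ E ⊔ span F {v} ⊔ span F {x})
    (hA : A ∈ span F {a x}) (hA' : a x ∈ span F {A}) (hAv : a (x + v) ∈ span F {a v + A})
    (hB' : a y ∈ span F {B}) (hBv : a (y + v) ∈ span F {a v + B})
    (hD : D ∈ span F {a (x + y)}) (hDv : a (x + y + v) ∈ span F {a v + D}) :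
    D = A + B := by
  set H := E ⊔ span F {v} with hH
  set C := a v with hC
  have hEH : E ≤ H := le_sup_left
  have hvH : v ∈ H := mem_sup_right (mem_span_singleton_self v)
  have hxm : x ∈ H ⊔ span F {x} := mem_sup_right (mem_span_singleton_self x)
  have hHx : H ≤ H ⊔ span F {x} := le_sup_left
  have hyH : y ∉ H := fun h => hy (hHx h)
  have hxyH : x + y ∉ H := fun h => hy (by simpa using sub_mem (hHx h) hxm)
  have hxE : x ∉ E := fun h => hx (hEH h)
  have hyE : y ∉ E := fun h => hyH (hEH h)
  have hxyE : x + y ∉ E := fun h => hxyH (hEH h)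
  have hzH : x + y + v ∉ H := by rwa [Submodule.add_mem_iff_left _ hvH]
  have hzE : x + y + v ∉ E := fun h => hzH (hEH h)
  have hxvE : x + v ∉ E := fun h => hx (by simpa using sub_mem (hEH h) hvH)
  -- linear independence of the three normalized representatives
  have hAC : A ∉ span F {C} := by
    intro h
    have : a x ∈ span F {C} := (span_singleton_le_iff_mem _ _).2 h hA'
    exact hx (mem_sup_right ((ha.point hv hxE).1 this))
  have hBAC : B ∉ span F {C, A} := by
    intro h
    have h1 : a y ∈ span F {C, A} := (span_singleton_le_iff_mem _ _).2 h hB'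
    have h2 : span F {C, A} ≤ span F {C, a x} := by
      rw [span_le]
      rintro z (rfl | rfl)
      · exact subset_span (by simp)
      · exact span_mono (by simp) hA
    have h3 : y ∈ span F {v, x} := (ha.line hv hx hyE).1 (h2 h1)
    rw [Set.pair_comm] at h3
    exact hy (span_pair_le_sup H x hvH h3)
  have ind : ∀ α β γ : F, α • A + β • B + γ • C = 0 → α = 0 ∧ β = 0 ∧ γ = 0 := by
    have hC0 : C ≠ 0 := fun h => ha.notMem hv (by rw [← hC, h]; exact zero_mem _)
    intro α β γ h
    have hβ : β = 0 := by
      by_contra h0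
      apply hBAC
      refine mem_span_pair.2 ⟨-(β⁻¹ * γ), -(β⁻¹ * α), ?_⟩
      have h1 : β⁻¹ • (α • A + β • B + γ • C) = 0 := by rw [h, smul_zero]
      have h2 : β⁻¹ • β • B = B := by rw [smul_smul, inv_mul_cancel₀ h0, one_smul]
      linear_combination (norm := module) (-1 : F) • h1 + (1 : F) • h2
    subst hβ
    have hα : α = 0 := by
      by_contra h0
      apply hAC
      refine mem_span_singleton.2 ⟨-(α⁻¹ * γ), ?_⟩
      have h1 : α⁻¹ • (α • A + (0 : F) • B + γ • C) = 0 := by rw [h, smul_zero]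
      have h2 : α⁻¹ • α • A = A := by rw [smul_smul, inv_mul_cancel₀ h0, one_smul]
      linear_combination (norm := module) (-1 : F) • h1 + (1 : F) • h2
    subst hα
    refine ⟨rfl, rfl, ?_⟩
    simpa [hC0] using h
  -- the image of `⟨x + y + v⟩`
  have hyxv : y ∉ E ⊔ span F {x + v} := fun h =>
    hy (sup_le (hEH.trans hHx) ((span_singleton_le_iff_mem _ _).2 (add_mem hxm (hHx hvH))) h)
  have hyvx : y + v ∉ E ⊔ span F {x} := fun h => hy (by
    simpa using sub_mem (sup_le_sup_right hEH (span F {x}) h) (hHx hvH))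
  have z1 : a (x + y + v) ∈ span F {C + A, B} := by
    have h1 : a (x + y + v) ∈ span F {a (x + v), a y} := (ha.line hxvE hyxv hzE).2
      (mem_span_pair.2 ⟨1, 1, by module⟩)
    refine span_le.2 ?_ h1
    rintro z (rfl | rfl)
    · exact span_mono (by simp) hAv
    · exact span_mono (by simp) hB'
  have z2 : a (x + y + v) ∈ span F {A, C + B} := by
    have h1 : a (x + y + v) ∈ span F {a x, a (y + v)} := (ha.line hxE hyvx hzE).2
      (mem_span_pair.2 ⟨1, 1, by module⟩)
    refine span_le.2 ?_ h1
    rintro z (rfl | rfl)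
    · exact span_mono (by simp) hA'
    · exact span_mono (by simp) hBv
  obtain ⟨s, t, hst⟩ := mem_span_pair.1 z1
  obtain ⟨s', t', hst'⟩ := mem_span_pair.1 z2
  obtain ⟨e1, e2, e3⟩ := ind (s - s') (t - t') (s - t') (by
    linear_combination (norm := module) (1 : F) • hst - (1 : F) • hst')
  obtain rfl : t = s := by linear_combination e2 - e3
  have hz : a (x + y + v) = t • (A + B + C) := by rw [← hst]; module
  have ht0 : t ≠ 0 := by
    rintro rfl
    exact ha.notMem hzE (by rw [hz, zero_smul]; exact zero_mem _)
  -- the image of `⟨x + y⟩`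
  have w1 : a (x + y) ∈ span F {A, B} := by
    have h1 : a (x + y) ∈ span F {a x, a y} :=
      (ha.line hxE (fun h => hy (sup_le_sup_right hEH _ h)) hxyE).2
        (mem_span_pair.2 ⟨1, 1, by module⟩)
    refine span_le.2 ?_ h1
    rintro z (rfl | rfl)
    · exact span_mono (by simp) hA'
    · exact span_mono (by simp) hB'
  have w2 : a (x + y) ∈ span F {C, a (x + y + v)} :=
    (ha.line hv hzH hxyE).2 (mem_span_pair.2 ⟨-1, 1, by module⟩)
  obtain ⟨α, β, hαβ⟩ := mem_span_pair.1 w1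
  obtain ⟨γ, δ, hγδ⟩ := mem_span_pair.1 w2
  rw [hz] at hγδ
  obtain ⟨f1, f2, f3⟩ := ind (α - δ * t) (β - δ * t) (-γ - δ * t) (by
    linear_combination (norm := module) (1 : F) • hαβ - (1 : F) • hγδ)
  obtain rfl : α = β := by linear_combination f1 - f2
  obtain ⟨μ, rfl⟩ := mem_span_singleton.1 hD
  obtain ⟨ν, hν⟩ := mem_span_singleton.1 hDv
  rw [hz] at hν
  rw [← hαβ] at hν ⊢
  obtain ⟨g1, g2, g3⟩ := ind (ν * (μ * α) - t) (ν * (μ * α) - t) (ν - t) (by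
    linear_combination (norm := module) (1 : F) • hν)
  obtain rfl : ν = t := by linear_combination g3
  have hμ : μ * α = 1 := mul_left_cancel₀ ht0 (by linear_combination g1)
  rw [← smul_add, smul_smul, hμ, one_smul]

/-- Representatives normalized against v₀ form an additive function off `H` = E + ⟨v₀⟩. Its
extension is semilinear, and finiteness turns injectivity into bijectivity for it and for σ. -/
theorem exists_gammaL [Finite F] [FiniteDimensional F V] (ha : IsCollineationOff E a)
    (hE : finrank F E + 4 ≤ finrank F V) :
    ∃ g : GammaL F V, ∀ v, v ∉ E → a v ∈ span F {(g : Equiv.Perm V) v} := by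
  have : Finite V := Module.finite_of_finite F
  obtain ⟨v₀, hv₀⟩ := exists_notMem_of_finrank_lt (W := E) (by omega)
  set H := E ⊔ span F {v₀} with hH
  have hEH : E ≤ H := le_sup_left
  have dH : finrank F H ≤ finrank F E + 1 := finrank_sup_span_singleton_le E v₀
  have hnorm : ∀ x, ∃ y, x ∉ H →
      y ∈ span F {a x} ∧ a x ∈ span F {y} ∧ a (x + v₀) ∈ span F {a v₀ + y} := by
    intro x
    by_cases hx : x ∈ H
    · exact ⟨0, fun h => absurd hx h⟩
    · exact (ha.exists_normalized hv₀ hx).imp fun _ h _ => h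
  choose g hg using hnorm
  have hoff : ∀ {x y}, x ∉ H → y ∉ H ⊔ span F {x} → y ∉ H ∧ x + y ∉ H := fun {x y} hx hy =>
    ⟨fun h => hy (mem_sup_left h), fun h => hy (by
      simpa using sub_mem (mem_sup_left h : _ ∈ H ⊔ span F {x})
        (mem_sup_right (mem_span_singleton_self x)))⟩
  -- Codimension at least four for `E` leaves at least three for `H`.
  obtain ⟨G, hG⟩ := exists_addMonoidHom_extension H (by omega) g fun x y hx hy =>
    have h := hoff hx hy
    ha.normalized_add hv₀ hx hy (hg x hx).1 (hg x hx).2.1 (hg x hx).2.2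
      (hg y h.1).2.1 (hg y h.1).2.2 (hg _ h.2).1 (hg _ h.2).2.2
  have hGa : ∀ x, x ∉ H → G x ∈ span F {a x} := fun x hx => hG x hx ▸ (hg x hx).1
  have haG : ∀ x, x ∉ H → a x ∈ span F {G x} := fun x hx => hG x hx ▸ (hg x hx).2.1
  have hoffE : ∀ {x}, x ∉ H → x ∉ E := fun hx h => hx (hEH h)
  have hpt : ∀ x z, x ∉ H → z ∉ H → G z ∈ span F {G x} → z ∈ span F {x} := by
    intro x z hx hz h
    refine (ha.point (hoffE hx) (hoffE hz)).1 ?_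
    have h1 := (span_singleton_le_iff_mem _ _).2 h (haG z hz)
    exact (span_singleton_le_iff_mem _ _).2 (hGa x hx) h1
  have hG0 : ∀ x, x ∉ H → G x ≠ 0 := by
    intro x hx h
    have := haG x hx
    rw [h, span_singleton_eq_bot.2 rfl, mem_bot] at this
    exact ha.notMem (hoffE hx) (this ▸ zero_mem _)
  obtain ⟨σ, hσ⟩ := exists_ringHom_of_addMonoidHom H (by omega) G
    (fun x hx c => by
      by_cases hc : c = 0
      · simp [hc]
      · have hcx : c • x ∉ H := by rwa [Submodule.smul_mem_iff _ hc]
        have h1 : a (c • x) ∈ span F {a x} := (ha.point (hoffE hx) (hoffE hcx)).2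
          (smul_mem _ _ (mem_span_singleton_self x))
        have h2 := (span_singleton_le_iff_mem _ _).2 h1 (hGa _ hcx)
        exact (span_singleton_le_iff_mem _ _).2 (haG x hx) h2)
    hG0
    (fun x y hx hy h => hy (mem_sup_right (hpt x y hx (hoff hx hy).1 h)))
  have hσb : Function.Bijective σ := Finite.injective_iff_bijective.1 σ.injective
  obtain ⟨x₀, hx₀⟩ := exists_notMem_of_finrank_lt (W := H) (by omega)
  have hinj : Function.Injective G := by
    rw [injective_iff_map_eq_zero]
    intro u hu
    by_cases huH : u ∈ H
    · have h1 : x₀ + u ∉ H := by rwa [Submodule.add_mem_iff_left _ huH]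
      have h2 := hpt x₀ (x₀ + u) hx₀ h1 (by
        rw [map_add, hu, add_zero]; exact mem_span_singleton_self _)
      have h3 : u ∈ span F {x₀} := by simpa using sub_mem h2 (mem_span_singleton_self x₀)
      obtain ⟨c, rfl⟩ := mem_span_singleton.1 h3
      by_cases hc : c = 0
      · simp [hc]
      · exact absurd ((Submodule.smul_mem_iff _ hc).1 huH) hx₀
    · exact absurd hu (hG0 u huH)
  have hbij : Function.Bijective G := Finite.injective_iff_bijective.1 hinj
  refine ⟨⟨Equiv.ofBijective G hbij, fun v w => map_add G v w,
    RingEquiv.ofBijective σ hσb, fun c v => hσ c v⟩, fun v hv => ?_⟩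
  change a v ∈ span F {G v}
  by_cases hvH : v ∈ H
  · obtain ⟨z₀, hz₀⟩ := exists_notMem_of_finrank_lt (W := H ⊔ span F {x₀}) (by
      have := finrank_sup_span_singleton_le H x₀
      omega)
    -- For v in `H` but off `E`, ⟨a v⟩ lies on the image of the line ⟨y, v⟩. Two choices of y
    -- independent modulo `H` pin it down to ⟨G v⟩.
    have key : ∀ y, y ∉ H → ∃ s t : F, a v = G (s • y + t • v) := by
      intro y hy
      have h1 : v + y ∉ E ⊔ span F {y} := by
        intro h
        have h2 : v ∈ E ⊔ span F {y} := by
          simpa using sub_mem h (mem_sup_right (mem_span_singleton_self y))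
        refine hy (by_contra fun _ => ?_)
        exact notMem_sup_span_symm hv (fun h' => hy (sup_le hEH
          ((span_singleton_le_iff_mem _ _).2 hvH) h')) h2
      have hvy : v + y ∉ H := by rwa [Submodule.add_mem_iff_right _ hvH]
      have h3 : a v ∈ span F {a y, a (v + y)} := (ha.line (hoffE hy) h1 hv).2
        (mem_span_pair.2 ⟨-1, 1, by module⟩)
      have h4 : a v ∈ span F {G y, G (v + y)} := by
        refine span_le.2 ?_ h3
        rintro z (rfl | rfl)
        · exact span_mono (by simp) (haG y hy)
        · exact span_mono (by simp) (haG _ hvy)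
      obtain ⟨s, t, hst⟩ := mem_span_pair.1 h4
      obtain ⟨s, rfl⟩ := hσb.2 s
      obtain ⟨t, rfl⟩ := hσb.2 t
      refine ⟨s + t, t, ?_⟩
      rw [← hst, ← hσ, ← hσ, ← map_add]
      congr 1
      module
    obtain ⟨s, t, hst⟩ := key x₀ hx₀
    obtain ⟨s', t', hst'⟩ := key z₀ (hoff hx₀ hz₀).1
    have e := hinj (hst.symm.trans hst')
    have hs' : s' = 0 := by
      by_contra h0
      apply hz₀
      rw [← Submodule.smul_mem_iff _ h0]
      have : s' • z₀ = (t - t') • v + s • x₀ := by linear_combination (norm := module) (-1 : F) • e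
      rw [this]
      exact add_mem (mem_sup_left (smul_mem _ _ hvH))
        (mem_sup_right (smul_mem _ _ (mem_span_singleton_self _)))
    rw [hst', hs', zero_smul, zero_add, hσ]
    exact smul_mem _ _ (mem_span_singleton_self _)
  · exact haG v hvH

end IsCollineationOff

end Collineation

/-! ### Semilinear maps on subspaces -/

section SemilinearAction

open Module Submodule

variable {F V : Type*} [Field F] [AddCommGroup V] [Module F V]

namespace GammaL

theorem smul_le_smul_iff (g : GammaL F V) {P Q : Submodule F V} : g • P ≤ g • Q ↔ P ≤ Q :=
  Set.image_subset_image_iff (g : Equiv.Perm V).injective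

theorem smul_inf (g : GammaL F V) (P Q : Submodule F V) : g • (P ⊓ Q) = g • P ⊓ g • Q :=
  SetLike.coe_injective (Set.image_inter (g : Equiv.Perm V).injective)

theorem map_zero (g : GammaL F V) : (g : Equiv.Perm V) 0 = 0 := by
  have h := g.2.1 0 0
  rwa [add_zero, left_eq_add] at h

theorem smul_disjoint (g : GammaL F V) {P Q : Submodule F V} (h : Disjoint P Q) :
    Disjoint (g • P) (g • Q) := by
  rw [disjoint_def]
  rintro _ ⟨x, hx, rfl⟩ ⟨y, hy, hxy⟩
  obtain rfl := (g : Equiv.Perm V).injective hxy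
  rw [disjoint_def.1 h _ hx hy, map_zero]

/-- A semilinear bijection preserves cardinality, which over a finite field determines dimension. -/
theorem finrank_smul [Finite F] [FiniteDimensional F V] (g : GammaL F V) (P : Submodule F V) :
    finrank F (g • P : Submodule F V) = finrank F P := by
  have h1 : Nat.card (g • P : Submodule F V) = Nat.card P :=
    Nat.card_image_of_injective (g : Equiv.Perm V).injective (P : Set V)
  rw [natCard_eq_pow_finrank (K := F), natCard_eq_pow_finrank (K := F) (V := P)] at h1
  exact Nat.pow_right_injective (Finite.one_lt_card : 2 ≤ Nat.card F) h1

theorem smul_mem_transversals [Finite F] [FiniteDimensional F V] {E : Submodule F V}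
    (g : GammaL F V) (hg : g • E = E) {P : Submodule F V} {m : ℕ} (hP : P ∈ transversals E m) :
    g • P ∈ transversals E m :=
  ⟨(finrank_smul g P).trans hP.1, hg ▸ smul_disjoint g hP.2⟩

theorem smul_span_singleton (g : GammaL F V) (v : V) :
    g • span F {v} = span F {(g : Equiv.Perm V) v} := by
  obtain ⟨g, hg, σ, hσ⟩ := g
  apply le_antisymm
  · rintro _ ⟨x, hx, rfl⟩
    obtain ⟨c, rfl⟩ := mem_span_singleton.1 hx
    exact mem_span_singleton.2 ⟨σ c, (hσ c v).symm⟩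
  · rw [span_singleton_le_iff_mem]
    exact ⟨v, mem_span_singleton_self v, rfl⟩

/-- Every vector off `E` is an eigenvector; comparing x and x + v₀ with v₀ equates the eigenvalues
off E + ⟨v₀⟩, and differences reach the rest. -/
theorem mem_scalarSubgroup [FiniteDimensional F V] {E : Submodule F V}
    (hE : finrank F E + 2 ≤ finrank F V) (g : GammaL F V)
    (h : ∀ v, v ∉ E → g • span F {v} = span F {v}) : g ∈ scalarSubgroup F V := by
  obtain ⟨v₀, hv₀⟩ := exists_notMem_of_finrank_lt (W := E) (by omega)
  obtain ⟨w, hw⟩ := exists_notMem_of_finrank_lt (W := E ⊔ span F {v₀}) (by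
    have := finrank_sup_span_singleton_le E v₀
    omega)
  have hc : ∀ v, v ∉ E → ∃ c : F, (g : Equiv.Perm V) v = c • v := by
    intro v hv
    have : (g : Equiv.Perm V) v ∈ span F {v} := by
      rw [← h v hv, smul_span_singleton]
      exact mem_span_singleton_self _
    exact (mem_span_singleton.1 this).imp fun _ h => h.symm
  obtain ⟨c, hc₀⟩ := hc v₀ hv₀
  have hvm : v₀ ∈ E ⊔ span F {v₀} := mem_sup_right (mem_span_singleton_self v₀)
  have off : ∀ x, x ∉ E ⊔ span F {v₀} → (g : Equiv.Perm V) x = c • x := by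
    intro x hx
    obtain ⟨d, hd⟩ := hc x fun h => hx (mem_sup_left h)
    obtain ⟨r, hr⟩ := hc (x + v₀) fun h => hx (by
      simpa using sub_mem (mem_sup_left h : _ ∈ E ⊔ span F {v₀}) hvm)
    rw [g.2.1, hd, hc₀] at hr
    have e : (d - r) • x = (r - c) • v₀ := by
      linear_combination (norm := module) (1 : F) • hr
    have h1 : d - r = 0 := by
      by_contra h0
      exact hx ((Submodule.smul_mem_iff _ h0).1 (e ▸ smul_mem _ _ hvm))
    rw [h1, zero_smul, eq_comm, smul_eq_zero] at e
    have h2 : r - c = 0 := e.resolve_right fun h => hv₀ (h ▸ zero_mem _)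
    rw [hd, sub_eq_zero.1 h1, sub_eq_zero.1 h2]
  have all : ∀ x, (g : Equiv.Perm V) x = c • x := by
    intro x
    by_cases hx : x ∈ E ⊔ span F {v₀}
    · have h1 := off (x + w) (by rwa [Submodule.add_mem_iff_right _ hx])
      rw [g.2.1, off w hw, smul_add] at h1
      exact add_right_cancel h1
    · exact off x hx
  have hc0 : c ≠ 0 := by
    rintro rfl
    have h1 := all v₀
    rw [zero_smul, ← map_zero g] at h1
    exact hv₀ ((g : Equiv.Perm V).injective h1 ▸ zero_mem _)
  exact ⟨Units.mk0 c hc0, all⟩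

/-- A semilinear map that fixes all subspaces of type `(m, 0)` is a scalar. -/
theorem mem_scalarSubgroup_of_fix [FiniteDimensional F V] {E : Submodule F V}
    (hE : E ≠ ⊥) (g : GammaL F V) {m : ℕ} (hm : 1 ≤ m) (hm' : m + finrank F E ≤ finrank F V)
    (hE' : finrank F E + 2 ≤ finrank F V) (h : ∀ P ∈ transversals E m, g • P = P) :
    g ∈ scalarSubgroup F V := by
  induction m, hm using Nat.le_induction with
  | base =>
    refine mem_scalarSubgroup hE' g fun v hv =>
      h _ (span_singleton_mem_transversals hv)
  | succ k hk ih =>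
    refine ih (by omega) fun U hU => ?_
    obtain ⟨P, hP, S, hS, -, -, rfl⟩ := exists_inf_eq hE hU (by omega)
    rw [smul_inf, h P hP, h S hS]

end GammaL

end SemilinearAction

/-! ### Automorphisms of the graph on transversals -/

section Automorphism

open Module Submodule

variable {F V : Type*} [Field F] [AddCommGroup V] [Module F V] {E : Submodule F V} {k m : ℕ}

/-- `τ` is an automorphism of the graph on `transversals E m` in which `P` and `Q` are adjacent when
`P ⊔ Q` is again a transversal, of dimension `m + 1`. -/
def IsTransversalAut (τ : transversals E m ≃ transversals E m) : Prop :=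
  ∀ P Q, (τ P).1 ⊔ (τ Q).1 ∈ transversals E (m + 1) ↔ P.1 ⊔ Q.1 ∈ transversals E (m + 1)

theorem IsTransversalAut.symm {τ : transversals E m ≃ transversals E m}
    (hτ : IsTransversalAut τ) : IsTransversalAut τ.symm := fun P Q => by
  have := hτ (τ.symm P) (τ.symm Q)
  rw [τ.apply_symm_apply, τ.apply_symm_apply] at this
  exact this.symm

variable [FiniteDimensional F V]

theorem IsTransversalAut.finrank_inf {τ : transversals E (k + 1) ≃ transversals E (k + 1)}
    (hτ : IsTransversalAut τ) (hE : E ≠ ⊥) (hn : k + 3 + finrank F E ≤ finrank F V)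
    {P Q : transversals E (k + 1)} (h : finrank F (P.1 ⊓ Q.1 : Submodule F V) = k) :
    finrank F ((τ P).1 ⊓ (τ Q).1 : Submodule F V) = k := by
  by_cases hadj : P.1 ⊔ Q.1 ∈ transversals E (k + 2)
  · exact finrank_inf_of_sup_mem (τ P).2 (τ Q).2 ((hτ P Q).2 hadj)
  · obtain ⟨R, hR, h01, h02, h03, h12, h13, hne, h23⟩ := exists_diamond hE hn P.2 Q.2 hadj h
    refine finrank_inf_of_diamond (τ P).2 (τ Q).2 ?_ (fun i => τ (R i))
      (fun i => ⟨(hτ _ _).2 (hR i).1, (hτ _ _).2 (hR i).2⟩) ((hτ _ _).2 h01) ((hτ _ _).2 h02)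
      ((hτ _ _).2 h03) ((hτ _ _).2 h12) ((hτ _ _).2 h13) (fun h => hne (τ.injective h))
      (fun h => h23 ((hτ _ _).1 h))
    intro heq
    obtain rfl := τ.injective (Subtype.ext heq)
    rw [inf_idem, P.2.1] at h
    omega

theorem IsTransversalAut.finrank_inf_iff {τ : transversals E (k + 1) ≃ transversals E (k + 1)}
    (hτ : IsTransversalAut τ) (hE : E ≠ ⊥) (hn : k + 3 + finrank F E ≤ finrank F V)
    (P Q : transversals E (k + 1)) :
    finrank F ((τ P).1 ⊓ (τ Q).1 : Submodule F V) = k ↔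
      finrank F (P.1 ⊓ Q.1 : Submodule F V) = k := by
  refine ⟨fun h => ?_, hτ.finrank_inf hE hn⟩
  have := hτ.symm.finrank_inf hE hn h
  rwa [τ.symm_apply_apply, τ.symm_apply_apply] at this

/-- The criterion `mem_star_iff` uses only adjacency and meeting in dimension k, both preserved by
τ, so the new centre is τP ∩ τS. -/
theorem IsTransversalAut.exists_star_image {τ : transversals E (k + 1) ≃ transversals E (k + 1)}
    (hτ : IsTransversalAut τ) (hE : E ≠ ⊥) (hn : k + 3 + finrank F E ≤ finrank F V)
    (U : transversals E k) : ∃ U' : transversals E k, ∀ T, U'.1 ≤ (τ T).1 ↔ U.1 ≤ T.1 := by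
  obtain ⟨U, hU⟩ := U
  obtain ⟨P, hP, S, hS, -, hadj, rfl⟩ := exists_inf_eq hE hU (by omega)
  have h' : finrank F ((τ ⟨P, hP⟩).1 ⊓ (τ ⟨S, hS⟩).1 : Submodule F V) = k :=
    hτ.finrank_inf hE hn hU.1
  refine ⟨⟨_, transversals_of_le (τ ⟨P, hP⟩).2 inf_le_left h'⟩, fun T => ?_⟩
  have hadj' : (τ ⟨P, hP⟩).1 ⊔ (τ ⟨S, hS⟩).1 ∉ transversals E (k + 2) := fun h =>
    hadj ((hτ ⟨P, hP⟩ ⟨S, hS⟩).1 h)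
  rw [mem_star_iff hn (τ ⟨P, hP⟩).2 (τ ⟨S, hS⟩).2 hadj' h' (τ T).2,
    mem_star_iff hn hP hS hadj hU.1 T.2]
  constructor
  · intro h R hR hRP hRS
    have := h _ (τ ⟨R, hR⟩).2 ((hτ ⟨R, hR⟩ ⟨P, hP⟩).2 hRP) ((hτ ⟨R, hR⟩ ⟨S, hS⟩).2 hRS)
    rw [hτ.finrank_inf_iff hE hn T ⟨R, hR⟩] at this
    refine this.imp_left fun h => ?_
    rw [τ.injective (Subtype.ext h)]
  · intro h R hR hRP hRS
    obtain ⟨⟨R, hR'⟩, hR⟩ : ∃ R', τ R' = ⟨R, hR⟩ := τ.surjective _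
    obtain rfl := congrArg Subtype.val hR
    rw [hτ.finrank_inf_iff hE hn T ⟨R, hR'⟩]
    refine (h R hR' ((hτ ⟨R, hR'⟩ ⟨P, hP⟩).1 hRP) ((hτ ⟨R, hR'⟩ ⟨S, hS⟩).1 hRS)).imp_left ?_
    rintro rfl
    rfl

theorem eq_of_star_eq (hE : E ≠ ⊥) (hn : k + 1 + finrank F E ≤ finrank F V)
    {U U' : transversals E k} (h : ∀ T : transversals E (k + 1), U.1 ≤ T.1 → U'.1 ≤ T.1) :
    U = U' := by
  obtain ⟨P, hP, S, hS, -, -, hPS⟩ := exists_inf_eq hE U.2 hn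
  refine Subtype.ext (eq_of_le_of_mem_transversals U'.2 U.2 ?_).symm
  rw [← hPS]
  exact le_inf (h ⟨P, hP⟩ (hPS ▸ inf_le_left)) (h ⟨S, hS⟩ (hPS ▸ inf_le_right))

/-- The maps on centres induced by τ and its inverse are mutually inverse, because a star determines
its centre. -/
theorem IsTransversalAut.exists_descent {τ : transversals E (k + 1) ≃ transversals E (k + 1)}
    (hτ : IsTransversalAut τ) (hE : E ≠ ⊥) (hn : k + 3 + finrank F E ≤ finrank F V) :
    ∃ β : transversals E k ≃ transversals E k, ∀ U T, (β U).1 ≤ (τ T).1 ↔ U.1 ≤ T.1 := by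
  choose β hβ using hτ.exists_star_image hE hn
  choose γ hγ using hτ.symm.exists_star_image hE hn
  refine ⟨⟨β, γ, fun U => ?_, fun U => ?_⟩, hβ⟩
  · refine (eq_of_star_eq hE (by omega) fun T hT => ?_).symm
    have := (hγ (β U) (τ T)).2 ((hβ U T).2 hT)
    rwa [τ.symm_apply_apply] at this
  · refine (eq_of_star_eq hE (by omega) fun T hT => ?_).symm
    have := (hβ (γ U) (τ.symm T)).2 ((hγ U T).2 hT)
    rwa [τ.apply_symm_apply] at this

theorem IsTransversalAut.of_incidence {τ : transversals E (k + 1) ≃ transversals E (k + 1)}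
    {β : transversals E k ≃ transversals E k} (h : ∀ U T, (β U).1 ≤ (τ T).1 ↔ U.1 ≤ T.1) :
    IsTransversalAut β := by
  intro U W
  rw [sup_mem_transversals_iff (β U).2 (β W).2, sup_mem_transversals_iff U.2 W.2]
  refine and_congr ?_ ⟨?_, ?_⟩
  · rw [not_iff_not]
    exact ⟨fun h => congrArg Subtype.val (β.injective (Subtype.ext h)),
      fun h => by rw [Subtype.ext h]⟩
  · rintro ⟨T, hT, h1, h2⟩
    obtain ⟨T', hT'⟩ := τ.surjective ⟨T, hT⟩
    obtain rfl := congrArg Subtype.val hT'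
    exact ⟨T'.1, T'.2, (h _ _).1 h1, (h _ _).1 h2⟩
  · rintro ⟨T, hT, h1, h2⟩
    exact ⟨_, (τ ⟨T, hT⟩).2, (h _ ⟨T, hT⟩).2 h1, (h _ ⟨T, hT⟩).2 h2⟩

/-- A collineation of the geometry of points outside `E` and lines disjoint from `E` is
semilinear. -/
theorem exists_gammaL_of_points_lines [Finite F] (hE : finrank F E + 4 ≤ finrank F V)
    (β : transversals E 1 ≃ transversals E 1) (τ : transversals E 2 ≃ transversals E 2)
    (h : ∀ U T, (β U).1 ≤ (τ T).1 ↔ U.1 ≤ T.1) :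
    ∃ g : GammaL F V, g • E = E ∧ ∀ p, (β p).1 = g • p.1 := by
  have : Finite V := Module.finite_of_finite F
  have hex : ∀ v, ∃ x, ∀ hv : v ∉ E, x ∉ E ∧
      (β ⟨span F {v}, span_singleton_mem_transversals hv⟩).1 = span F {x} := by
    intro v
    by_cases hv : v ∈ E
    · exact ⟨0, fun h => absurd hv h⟩
    · exact (exists_eq_span_singleton (β ⟨_, span_singleton_mem_transversals hv⟩).2).imp
        fun _ h _ => h
  choose a ha using hex
  have hcol : IsCollineationOff E a := by
    refine ⟨fun hv => (ha _ hv).1, ?_, ?_⟩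
    · intro v z hv hz
      rw [← span_singleton_le_iff_mem, ← span_singleton_le_iff_mem, ← (ha v hv).2, ← (ha z hz).2]
      constructor
      · intro hle
        have := β.injective (Subtype.ext (eq_of_le_of_mem_transversals (β _).2 (β _).2 hle))
        exact (congrArg Subtype.val this).le
      · intro hle
        have := eq_of_le_of_mem_transversals (span_singleton_mem_transversals hz)
          (span_singleton_mem_transversals hv) hle
        simp only [this, le_refl]
    · intro v w z hv hw hz
      have hwE : w ∉ E := fun h => hw (mem_sup_left h)
      have hL : span F {v} ⊔ span F {w} ∈ transversals E 2 :=
        sup_span_mem_transversals (span_singleton_mem_transversals hv) (by rwa [sup_comm])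
      have hL' : (β ⟨_, span_singleton_mem_transversals hv⟩).1 ⊔
          (β ⟨_, span_singleton_mem_transversals hwE⟩).1 = (τ ⟨_, hL⟩).1 :=
        eq_of_le_of_mem_transversals ((IsTransversalAut.of_incidence h _ _).2 hL) (τ ⟨_, hL⟩).2
          (sup_le ((h _ _).2 le_sup_left) ((h _ _).2 le_sup_right))
      rw [span_insert, span_insert, ← (ha v hv).2, ← (ha w hwE).2, hL',
        ← span_singleton_le_iff_mem, ← span_singleton_le_iff_mem, ← (ha z hz).2]
      exact h ⟨_, span_singleton_mem_transversals hz⟩ ⟨_, hL⟩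
  obtain ⟨g, hg⟩ := hcol.exists_gammaL hE
  have hgE : ∀ v, v ∉ E → (g : Equiv.Perm V) v ∉ E := fun v hv h =>
    (ha v hv).1 ((span_singleton_le_iff_mem _ _).2 h (hg v hv))
  refine ⟨g, ?_, ?_⟩
  -- As g keeps the complement of `E` off `E`, preimages of vectors of `E` lie in `E`; so E ≤ gE,
  -- and dimensions agree.
  · refine (eq_of_le_of_finrank_eq (fun x hx => ?_) (GammaL.finrank_smul g E).symm).symm
    obtain ⟨y, rfl⟩ := (g : Equiv.Perm V).surjective x
    exact ⟨y, by_contra fun hy => hgE y hy hx, rfl⟩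
  · rintro ⟨p, hp⟩
    obtain ⟨v, hv, rfl⟩ := exists_eq_span_singleton hp
    change _ = g • span F {v}
    rw [(ha v hv).2, GammaL.smul_span_singleton]
    exact eq_of_le_of_mem_transversals (span_singleton_mem_transversals (ha v hv).1)
      (span_singleton_mem_transversals (hgE v hv)) ((span_singleton_le_iff_mem _ _).2 (hg v hv))

/-- Each vector of T lies in a k-dimensional U ≤ T, and gU = βU ≤ τT. -/
theorem eq_smul_of_incidence [Finite F] (hk : 1 ≤ k)
    {τ : transversals E (k + 1) ≃ transversals E (k + 1)}
    {β : transversals E k ≃ transversals E k} (h : ∀ U T, (β U).1 ≤ (τ T).1 ↔ U.1 ≤ T.1)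
    {g : GammaL F V} (hg : g • E = E) (hβ : ∀ U, (β U).1 = g • U.1)
    (T : transversals E (k + 1)) : (τ T).1 = g • T.1 := by
  refine (eq_of_le_of_mem_transversals (GammaL.smul_mem_transversals g hg T.2) (τ T).2 ?_).symm
  rintro _ ⟨x, hx, rfl⟩
  obtain ⟨U, hxU, hUT, hU⟩ := exists_le_finrank_eq (span F {x}) T.1
    ((span_singleton_le_iff_mem _ _).2 hx) k ((finrank_span_le_card _).trans (by simpa using hk))
    (by rw [T.2.1]; omega)
  have hUX : U ∈ transversals E k := transversals_of_le T.2 hUT hU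
  have := (h ⟨U, hUX⟩ T).2 hUT
  rw [hβ] at this
  exact this ⟨x, (span_singleton_le_iff_mem _ _).1 hxU, rfl⟩

/-- The induction starts at m = 2: for points alone the graph is complete multipartite and has too
many automorphisms, so the permutation of lines must be kept as well. -/
theorem IsTransversalAut.exists_gammaL [Finite F] (hE : E ≠ ⊥) (hm : 2 ≤ m)
    (hn : m + 2 + finrank F E ≤ finrank F V) {τ : transversals E m ≃ transversals E m}
    (hτ : IsTransversalAut τ) : ∃ g : GammaL F V, g • E = E ∧ ∀ P, (τ P).1 = g • P.1 := by
  induction m, hm using Nat.le_induction with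
  | base =>
    obtain ⟨β, hβ⟩ := hτ.exists_descent hE (by omega)
    obtain ⟨g, hg, h⟩ := exists_gammaL_of_points_lines (by omega) β τ hβ
    exact ⟨g, hg, eq_smul_of_incidence le_rfl hβ hg h⟩
  | succ k hk ih =>
    obtain ⟨β, hβ⟩ := hτ.exists_descent hE (by omega)
    obtain ⟨g, hg, h⟩ := ih (by omega) (IsTransversalAut.of_incidence hβ)
    exact ⟨g, hg, eq_smul_of_incidence (by omega) hβ hg h⟩

end Automorphism

/-! ### Attenuated spaces: the graph of subspaces of type `(m, 0)` -/

section AttenuatedAut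

open Module Submodule

variable {F : Type*} [Field F] {n l m : ℕ}

theorem ker_funLeft_castAdd :
    LinearMap.ker (LinearMap.funLeft F F (Fin.castAdd (n := n) l)) = subspaceE F n l := by
  apply le_antisymm
  · intro x hx
    have hx' : ∀ i : Fin n, x (Fin.castAdd l i) = 0 := fun i => congrFun hx i
    have : x = ∑ i : Fin l, x (Fin.natAdd n i) • Pi.single (Fin.natAdd n i) (1 : F) := by
      funext j
      rw [Finset.sum_apply]
      refine Fin.addCases (fun i => ?_) (fun i => ?_) j
      · rw [hx', Finset.sum_eq_zero]
        intro b _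
        have : Fin.castAdd l i ≠ Fin.natAdd n b := by
          intro h
          have := congrArg Fin.val h
          simp at this
          omega
        simp [this]
      · rw [Finset.sum_eq_single i]
        · simp
        · intro b _ hb
          have : Fin.natAdd n i ≠ Fin.natAdd n b := fun h => hb (Fin.natAdd_injective _ _ h).symm
          simp [this]
        · simp
    rw [this]
    exact sum_mem fun i _ => smul_mem _ _ (subset_span ⟨i, rfl⟩)
  · unfold subspaceE
    rw [span_le]
    rintro _ ⟨i, rfl⟩
    change LinearMap.funLeft F F (Fin.castAdd l) _ = 0
    funext j
    have : Fin.castAdd l j ≠ Fin.natAdd n i := by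
      intro h
      have := congrArg Fin.val h
      simp at this
      omega
    simp [LinearMap.funLeft_apply, this]

theorem finrank_subspaceE : finrank F (subspaceE F n l) = l := by
  have h := LinearMap.finrank_range_add_finrank_ker
    (LinearMap.funLeft F F (Fin.castAdd (n := n) l))
  rw [ker_funLeft_castAdd, LinearMap.range_eq_top.2
    (LinearMap.funLeft_surjective_of_injective F F _ (Fin.castAdd_injective n l)),
    finrank_top, finrank_fin_fun, finrank_fin_fun] at h
  omega

theorem subspaceE_ne_bot (hl : 0 < l) : subspaceE F n l ≠ ⊥ := by
  intro h
  have := finrank_subspaceE (F := F) (n := n) (l := l)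
  rw [h, finrank_bot] at this
  omega

theorem attX_eq_transversals : attX F n l m = transversals (subspaceE F n l) m := by
  ext P
  exact and_congr_right fun _ => by rw [finrank_eq_zero, disjoint_iff]

theorem finrank_map_add_finrank_inf_ker {V W : Type*} [AddCommGroup V] [Module F V]
    [AddCommGroup W] [Module F W] [FiniteDimensional F V] (f : V →ₗ[F] W) (P : Submodule F V) :
    finrank F (P.map f) + finrank F (P ⊓ LinearMap.ker f : Submodule F V) = finrank F P := by
  have h := LinearMap.finrank_range_add_finrank_ker (f.domRestrict P)
  rw [LinearMap.range_domRestrict] at h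
  rw [← h, LinearMap.ker_domRestrict, ← map_comap_subtype,
    LinearEquiv.finrank_eq (equivMapOfInjective P.subtype P.injective_subtype _)]

theorem finrank_firstPart (P : Submodule F (Fin (n + l) → F)) :
    finrank F (firstPart P) + finrank F (P ⊓ subspaceE F n l : Submodule F (Fin (n + l) → F)) =
      finrank F P := by
  rw [← ker_funLeft_castAdd]
  exact finrank_map_add_finrank_inf_ker _ P

/-- Both conditions become dimensions of sums: dim(P + Q) = m + 1 = dim(P' + Q'), and the difference
of these two is dim((P + Q) ∩ E). -/
theorem attGraph_adj_iff (P Q : attX F n l m) :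
    (attGraph F n l m).Adj P Q ↔ P.1 ⊔ Q.1 ∈ transversals (subspaceE F n l) (m + 1) := by
  have hP := finrank_firstPart P.1
  have hQ := finrank_firstPart Q.1
  have hPQ := finrank_firstPart (P.1 ⊔ Q.1)
  have hs : firstPart (P.1 ⊔ Q.1) = firstPart P.1 ⊔ firstPart Q.1 := Submodule.map_sup _ _ _
  rw [hs] at hPQ
  rw [P.2.2, P.2.1] at hP
  rw [Q.2.2, Q.2.1] at hQ
  have h1 := finrank_sup_add_finrank_inf_eq P.1 Q.1
  rw [P.2.1, Q.2.1] at h1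
  have h2 := finrank_sup_add_finrank_inf_eq (firstPart P.1) (firstPart Q.1)
  change _ ∧ _ ↔ _ ∧ _
  rw [disjoint_iff, ← finrank_eq_zero (R := F)]
  omega

theorem PGammaL.smul_le_smul {g : PGammaL F (Fin (n + l) → F)}
    {P Q : Submodule F (Fin (n + l) → F)} (h : P ≤ Q) : g • P ≤ g • Q := by
  obtain ⟨g, rfl⟩ := QuotientGroup.mk'_surjective (scalarSubgroup F (Fin (n + l) → F)) g
  exact (GammaL.smul_le_smul_iff g).2 h

variable [Finite F]

theorem smul_mem_attX {g : PGammaL F (Fin (n + l) → F)} (hg : g • subspaceE F n l = subspaceE F n l)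
    {P : Submodule F (Fin (n + l) → F)} (hP : P ∈ attX F n l m) : g • P ∈ attX F n l m := by
  obtain ⟨g, rfl⟩ := QuotientGroup.mk'_surjective (scalarSubgroup F (Fin (n + l) → F)) g
  rw [attX_eq_transversals] at hP ⊢
  exact GammaL.smul_mem_transversals g hg hP

theorem attGraph_adj_smul {g : PGammaL F (Fin (n + l) → F)}
    (hg : g • subspaceE F n l = subspaceE F n l) {P Q : attX F n l m}
    (h : (attGraph F n l m).Adj P Q) :
    (attGraph F n l m).Adj ⟨g • P.1, smul_mem_attX hg P.2⟩ ⟨g • Q.1, smul_mem_attX hg Q.2⟩ := by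
  have hX : ∀ P : attX F n l m, P.1 ∈ transversals (subspaceE F n l) m := fun P =>
    attX_eq_transversals (F := F) (n := n) (l := l) (m := m) ▸ P.2
  rw [attGraph_adj_iff, sup_mem_transversals_iff (hX _) (hX _)] at h ⊢
  obtain ⟨hne, W, hW, h1, h2⟩ := h
  rw [← attX_eq_transversals] at hW ⊢
  exact ⟨fun h => hne (MulAction.injective g h), g • W, smul_mem_attX hg hW,
    PGammaL.smul_le_smul h1, PGammaL.smul_le_smul h2⟩

/-- The action of `PΓL(n+l, F)_E` on the graph `Γ^(m)`. -/
def stabEToAut (F : Type*) [Field F] [Finite F] (n l m : ℕ) :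
    PGammaLStabE F n l →* (attGraph F n l m ≃g attGraph F n l m) where
  toFun g :=
    { toFun := fun P => ⟨g.1 • P.1, smul_mem_attX g.2 P.2⟩
      invFun := fun P => ⟨g⁻¹.1 • P.1, smul_mem_attX g⁻¹.2 P.2⟩
      left_inv := fun P => Subtype.ext (inv_smul_smul g.1 P.1)
      right_inv := fun P => Subtype.ext (smul_inv_smul g.1 P.1)
      map_rel_iff' := fun {P Q} => by
        refine ⟨fun h => ?_, fun h => attGraph_adj_smul g.2 h⟩
        have := attGraph_adj_smul g⁻¹.2 h
        convert this using 1
        · exact Subtype.ext (inv_smul_smul g.1 P.1).symm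
        · exact Subtype.ext (inv_smul_smul g.1 Q.1).symm }
  map_one' := RelIso.ext fun P => Subtype.ext (one_smul _ P.1)
  map_mul' g h := RelIso.ext fun P => Subtype.ext (mul_smul g.1 h.1 P.1)

theorem stabEToAut_injective (hm : 1 < m) (hmn : m + 1 < n) (hl : 0 < l) :
    Function.Injective (stabEToAut F n l m) := by
  rw [injective_iff_map_eq_one]
  rintro ⟨g, hg⟩ h
  refine Subtype.ext ?_
  obtain ⟨g, rfl⟩ := QuotientGroup.mk'_surjective (scalarSubgroup F (Fin (n + l) → F)) g
  have hE := finrank_subspaceE (F := F) (n := n) (l := l)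
  have hV : finrank F (Fin (n + l) → F) = n + l := finrank_fin_fun F
  refine (QuotientGroup.eq_one_iff g).2 (GammaL.mem_scalarSubgroup_of_fix
    (subspaceE_ne_bot (F := F) (n := n) hl) g hm.le (by omega) (by omega) fun P hP => ?_)
  rw [← attX_eq_transversals] at hP
  exact congrArg Subtype.val (DFunLike.congr_fun h ⟨P, hP⟩)

theorem stabEToAut_surjective (hm : 1 < m) (hmn : m + 1 < n) (hl : 0 < l) :
    Function.Surjective (stabEToAut F n l m) := by
  intro τ
  have hE := finrank_subspaceE (F := F) (n := n) (l := l)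
  have hV : finrank F (Fin (n + l) → F) = n + l := finrank_fin_fun F
  let e : attX F n l m ≃ transversals (subspaceE F n l) m := Equiv.setCongr attX_eq_transversals
  have hτ : IsTransversalAut ((e.symm.trans τ.toEquiv).trans e) := fun P Q =>
    (attGraph_adj_iff (τ (e.symm P)) (τ (e.symm Q))).symm.trans
      (τ.map_rel_iff.trans (attGraph_adj_iff (e.symm P) (e.symm Q)))
  obtain ⟨g, hg, h⟩ := hτ.exists_gammaL (subspaceE_ne_bot hl) hm (by omega)
  exact ⟨⟨PGammaL.mk g, hg⟩, RelIso.ext fun P => Subtype.ext (h (e P)).symm⟩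

end AttenuatedAut

theorem lemma2p6 (F : Type*) [Field F] [Finite F] (n l m : ℕ)
    (hm : 1 < m) (hmn : m + 1 < n) (hl : 0 < l) :
    ∃ φ : PGammaLStabE F n l ≃* (attGraph F n l m ≃g attGraph F n l m),
      ∀ (g : PGammaLStabE F n l) (P : attX F n l m),
        (φ g P : Submodule F (Fin (n + l) → F)) =
          (g : PGammaL F (Fin (n + l) → F)) • (P : Submodule F (Fin (n + l) → F)) :=
  ⟨MulEquiv.ofBijective (stabEToAut F n l m)
    ⟨stabEToAut_injective hm hmn hl, stabEToAut_surjective hm hmn hl⟩, fun _ _ => rfl⟩
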